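/- Let $\alpha>0$, let $H$ be a separable complex Hilbert space, let $\mathcal L$ be the space of bounded linear operators on $H$, let $\mathbb D$ be the open unit disc, and let $\varphi:\mathbb D\to\mathcal L$ be analytic. Write $\hat f(n)$ for the Taylor coefficients at $0$ of an analytic function $f$ on $\mathbb D$, and for $\gamma\in\mathbb R$ put $$D^\gamma f(z)=\sum_{n\ge 0}(1+n)^\gamma\hat f(n)z^n ,\qquad\text{so that } Df(z)=D^1f(z)=zf'(z)+f(z).$$ Let $\|f\|_{H^2(H)}^2=\sup_{0<r<1}\frac1{2\pi}\int_0^{2\pi}\|f(re^{i\theta})\|_H^2\,d\theta$, let $\mathcal O(H)$ be the set of $H$-valued analytic functions on $\mathbb D$ that extend analytically to a larger disc centred at $0$, and let $\mathcal O_1(H)=\{f\in\mathcal O(H):\|f\|_{H^2(H)}=1\}$. For $f\in\mathcal O(H)$ let $$\Gamma_\varphi f(z)=\sum_{n\ge0}\Big(\sum_{m\ge0}\hat\varphi(m+n)\hat f(m)\Big)z^n ,\qquad z\in\mathbb D .$$ The operator $D^\alpha\Gamma_\varphi$ is called bounded on $H^2(H)$ if there is a constant $M<\infty$ with $\|D^\alpha\Gamma_\varphi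 f\|_{H^2(H)}\le M\|f\|_{H^2(H)}$ for all $f\in\mathcal O(H)$; this holds if and only if $$\|D^\alpha\Gamma_\varphi\|:=\sup_{f\in\mathcal O_1(H)}\|D^\alpha\Gamma_\varphi f\|_{H^2(H)}<\infty .$$ An analytic $\psi:\mathbb D\to\mathcal L$ belongs to $\mathrm{BMOA}_{\mathcal C}(\mathcal L)$ if $$\|\psi\|_{\mathrm{BMOA}_{\mathcal C}}^2:=\sup_{f\in\mathcal O_1(H)}\int_{\mathbb D}\|(D\psi)(z)f(\bar z)\|_H^2\,(1-|z|^2)\,dA(z)<\infty ,$$ where $dA$ is area measure. (Suprema of nonnegative quantities are taken in $[0,\infty]$; the supremum over the empty set is $0$.) Then $D^\alpha\Gamma_\varphi$ is bounded on $H^2(H)$ if and only if $D^\alpha\varphi\in\mathrm{BMOA}_{\mathcal C}(\mathcal L)$, that is, if and only if $$\|D^\alpha\varphi\|_{\mathrm{BMOA}_{\mathcal C}}^2=\sup_{f\in\mathcal O_1(H)}\int_{\mathbb D}\|(D^{1+\alpha}\varphi)(z)f(\bar z)\|_H^2\,(1-|z|^2)\,dA(z)<\infty .$$ Moreover, there is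 a constant $C>0$, depending only on $\alpha$, such that $$\|D^\alpha\Gamma_\varphi\|\le C\,\|D^\alpha\varphi\|_{\mathrm{BMOA}_{\mathcal C}}\quad\text{and}\quad\|D^\alpha\varphi\|_{\mathrm{BMOA}_{\mathcal C}}\le C\,\|D^\alpha\Gamma_\varphi\| .$$ -/

import Mathlib

open MeasureTheory Metric Set
open scoped NNReal ENNReal ComplexConjugate

namespace VectorHankel

/-- The functions analytic on the open unit disc, with values in a complex Banach space `Y`.
Only the values on the open unit disc matter. -/
def Hol (Y : Type*) [NormedAddCommGroup Y] [NormedSpace ℂ Y] : Set (ℂ → Y) :=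
  {f | DifferentiableOn ℂ f (ball (0 : ℂ) 1)}

/-- The functions analytic on the open unit disc that admit an analytic extension to a larger
disc centred at the origin. -/
def HolExt (Y : Type*) [NormedAddCommGroup Y] [NormedSpace ℂ Y] : Set (ℂ → Y) :=
  {f | ∃ R : ℝ, 1 < R ∧ ∃ g : ℂ → Y, DifferentiableOn ℂ g (ball (0 : ℂ) R) ∧
    EqOn f g (ball (0 : ℂ) 1)}

/-- The `n`th Taylor coefficient of `f` at the origin. -/
noncomputable def taylorCoeff {Y : Type*} [NormedAddCommGroup Y] [NormedSpace ℂ Y]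
    (f : ℂ → Y) (n : ℕ) : Y :=
  ((n.factorial : ℂ)⁻¹) • iteratedDeriv n f 0

/-- The differentiation operator `D f (z) = z f'(z) + f(z)`. -/
noncomputable def diffOp {Y : Type*} [NormedAddCommGroup Y] [NormedSpace ℂ Y]
    (f : ℂ → Y) : ℂ → Y :=
  fun z => z • deriv f z + f z

/-- The powers of `D`: `D ^ α f (z) = ∑ (1 + n) ^ α f̂(n) z ^ n`. -/
noncomputable def fracDiff {Y : Type*} [NormedAddCommGroup Y] [NormedSpace ℂ Y]
    (α : ℝ) (f : ℂ → Y) : ℂ → Y :=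
  fun z => ∑' n : ℕ, (z ^ n * (((1 + (n : ℝ)) ^ α : ℝ) : ℂ)) • taylorCoeff f n

/-- Normalized Lebesgue measure `m` on the unit circle, in the angular variable. -/
noncomputable def angleMeasure : Measure ℝ :=
  (ENNReal.ofReal (2 * Real.pi))⁻¹ • volume.restrict (Ioc 0 (2 * Real.pi))

/-- The `H ^ 2` norm, with values in `[0, ∞]`: the supremum over `0 < r < 1` of the norm of
`ζ ↦ f (r ζ)` in `L ^ 2` of the unit circle. -/
noncomputable def hardyNorm {Y : Type*} [NormedAddCommGroup Y] (f : ℂ → Y) : ℝ≥0∞ :=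
  ⨆ r ∈ Ioo (0 : ℝ) 1, eLpNorm (fun θ : ℝ => f (circleMap 0 r θ)) 2 angleMeasure

/-- The functions in `HolExt H` that have `H ^ 2` norm one. -/
def HolExtOne (H : Type*) [NormedAddCommGroup H] [NormedSpace ℂ H] : Set (ℂ → H) :=
  {f | f ∈ HolExt H ∧ hardyNorm f = 1}

/-- The Hankel operator with symbol `φ`:
`Γ_φ f (z) = ∑_n (∑_m φ̂(m + n) f̂(m)) z ^ n`. -/
noncomputable def hankel {H : Type*} [NormedAddCommGroup H] [NormedSpace ℂ H]
    (φ : ℂ → H →L[ℂ] H) (f : ℂ → H) : ℂ → H :=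
  fun z => ∑' n : ℕ, z ^ n • ∑' m : ℕ, taylorCoeff φ (m + n) (taylorCoeff f m)

/-- The operator norm on `H ^ 2` of an operator that is given on the dense subspace `HolExt H`,
with values in `[0, ∞]`. -/
noncomputable def hardyOpNorm {H : Type*} [NormedAddCommGroup H] [NormedSpace ℂ H]
    (T : (ℂ → H) → (ℂ → H)) : ℝ≥0∞ :=
  ⨆ f ∈ HolExtOne H, hardyNorm (T f)

/-- Boundedness with respect to the `H ^ 2` norm of an operator that is given on the dense
subspace `HolExt H`. -/
def HardyBounded {H : Type*} [NormedAddCommGroup H] [NormedSpace ℂ H]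
    (T : (ℂ → H) → (ℂ → H)) : Prop :=
  ∃ C : ℝ≥0, ∀ f ∈ HolExt H, hardyNorm (T f) ≤ C * hardyNorm f

/-- The anti-analytic Carleson embedding quantity of an operator-valued density `Ψ`:
the supremum over `f` of `∫ ‖Ψ(z) f(z̄)‖² (1 - |z|²) dA(z)` over the unit disc, where `dA` is
area measure. -/
noncomputable def antiCarleson {H : Type*} [NormedAddCommGroup H] [NormedSpace ℂ H]
    (Ψ : ℂ → H →L[ℂ] H) : ℝ≥0∞ :=
  ⨆ f ∈ HolExtOne H, ∫⁻ z in ball (0 : ℂ) 1,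
    ‖Ψ z (f (conj z))‖ₑ ^ 2 * ENNReal.ofReal (1 - ‖z‖ ^ 2)

/-- The norm of Carleson `BMOA`, with values in `[0, ∞]`. -/
noncomputable def carlesonNorm {H : Type*} [NormedAddCommGroup H] [NormedSpace ℂ H]
    (ψ : ℂ → H →L[ℂ] H) : ℝ≥0∞ :=
  antiCarleson (diffOp ψ) ^ (1 / 2 : ℝ)

/-- Carleson `BMOA`. -/
def BMOACarleson (H : Type*) [NormedAddCommGroup H] [NormedSpace ℂ H] :
    Set (ℂ → H →L[ℂ] H) :=
  {ψ | ψ ∈ Hol (H →L[ℂ] H) ∧ carlesonNorm ψ < ∞}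

end VectorHankel

open VectorHankel

/-!
# Hankel operators `D ^ α Γ_φ` and Carleson `BMOA`

Everything is expressed through the Taylor coefficients `a_k` of `φ` and `c_m` of `f`. By Parseval's
identity the `H ^ 2` norm is the `ℓ ^ 2` norm of the coefficients, so that the square of the norm of
`D ^ α Γ_φ f` is the sum over `n ≥ 0` of `‖(1 + n) ^ α γ_n‖ ^ 2`, where `γ_n = ∑_m a_{m + n} c_m`
(`hardyNorm_fracDiff_hankel_sq`). On the circle `|z| = e ^ (-s / 2)` the Fourier coefficients of
`z ↦ (D ^ (1 + α) φ)(z) f(z̄)` are `e ^ (-n s / 2) h_n(s)`, `n ∈ ℤ`, where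
`h_n(s) = ∑_m e ^ (-m s) (1 + m + n) ^ (1 + α) a_{m + n} c_m`, with `a_k = 0` for `k < 0`. Integrating
Parseval's identity over the radius turns the Carleson integral into
`π ∑_n ∫_0^∞ (1 - e ^ (-s)) e ^ (-(n + 1) s) ‖h_n(s)‖ ^ 2 ds` (`lintegral_carleson`).

*Carleson implies bounded.* Euler's integral gives
`Γ(1 + α) γ_n = ∫_0^∞ s ^ α e ^ (-(n + 1) s) h_n(s) ds`, and the Cauchy–Schwarz inequality bounds
`(1 + n) ^ (2 α) ‖γ_n‖ ^ 2` by the `n`th term of the sum above (`hankelCoeff_sq_le_modeEnergy`). Since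
the weight `1 - e ^ (-s)` is of order `s` near `0`, this needs the convergence of
`∫ s ^ (2 α - 1) ds` at the origin, that is, `0 < α`.

*Bounded implies Carleson.* Testing on `f(w) = x / (1 - z w)` gives the pointwise bound
`‖(D ^ (1 + α) φ)(z)‖ ≤ (1 + α) ‖D ^ α Γ_φ‖ / (1 - |z| ^ 2)` (`enorm_tsum_smul_apply_sq_le`). This bound
is not sufficient by itself: inserted into the Carleson integral it leads to a divergent integral.
The derivative `h_n'` is, up to sign, the function `h_n` of the sequence `m c_m`, and for it the
pointwise bound does suffice: it yields that `∑_n ∫_0^∞ s ^ 3 e ^ (-n s) ‖h_n'(s)‖ ^ 2 ds` is at most a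
constant times `‖D ^ α Γ_φ‖ ^ 2 ‖f‖ ^ 2` (`tsum_modeDerivEnergy_le`).

Hardy inequalities then recover `h_n` from `h_n'`. For `n < 0` the function `h_n` vanishes at infinity,
and `hardy_of_tendsto_zero` suffices. For `n ≥ 0`, with `N = n + 1`, `hardy_sub_apply_inv` controls the
deviation of `h_n` from the constant `h_n(1 / N)`. That constant is compared with the average of `h_n`
with respect to the weight `s ^ α e ^ (-N s)`, which equals `N ^ (1 + α) γ_n`, so that what remains is
the `n`th coefficient of `D ^ α Γ_φ f` (`modeEnergy_le_of_nonneg`); the comparison is again the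
Cauchy–Schwarz inequality of the first direction, applied to `h_n - h_n(1 / N)`.
-/

namespace VectorHankel

/-! ### Cauchy–Schwarz and Tonelli for `ℝ≥0∞`-valued functions -/

theorem lintegral_mul_sq_le {X : Type*} [MeasurableSpace X] (μ : Measure X) {f g : X → ℝ≥0∞}
    (hf : AEMeasurable f μ) (hg : AEMeasurable g μ) :
    (∫⁻ x, f x * g x ∂μ) ^ 2 ≤ (∫⁻ x, f x ^ 2 ∂μ) * ∫⁻ x, g x ^ 2 ∂μ := by
  have h := ENNReal.lintegral_mul_le_Lp_mul_Lq μ Real.HolderConjugate.two_two hf hg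
  simp only [Pi.mul_apply, ENNReal.rpow_two] at h
  calc (∫⁻ x, f x * g x ∂μ) ^ 2
      ≤ ((∫⁻ x, f x ^ 2 ∂μ) ^ (1 / 2 : ℝ) * (∫⁻ x, g x ^ 2 ∂μ) ^ (1 / 2 : ℝ)) ^ 2 := by gcongr
    _ = _ := by
      rw [mul_pow, ← ENNReal.rpow_two, ← ENNReal.rpow_two, ← ENNReal.rpow_mul,
        ← ENNReal.rpow_mul]
      norm_num

theorem tsum_mul_sq_le {ι : Type*} (f g : ι → ℝ≥0∞) :
    (∑' i, f i * g i) ^ 2 ≤ (∑' i, f i ^ 2) * ∑' i, g i ^ 2 := by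
  let _ : MeasurableSpace ι := ⊤
  simpa only [lintegral_count] using lintegral_mul_sq_le (Measure.count (α := ι))
    (measurable_from_top (f := f)).aemeasurable (measurable_from_top (f := g)).aemeasurable

theorem enorm_add_sq_le {E : Type*} [NormedAddCommGroup E] (x y : E) :
    ‖x + y‖ₑ ^ 2 ≤ 2 * (‖x‖ₑ ^ 2 + ‖y‖ₑ ^ 2) := by
  calc ‖x + y‖ₑ ^ 2 ≤ (‖x‖ₑ + ‖y‖ₑ) ^ 2 := by gcongr; exact enorm_add_le x y
    _ ≤ 2 * (‖x‖ₑ ^ 2 + ‖y‖ₑ ^ 2) := by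
      rw [← ofReal_norm, ← ofReal_norm, ← ENNReal.ofReal_add (by positivity) (by positivity),
        ← ENNReal.ofReal_pow (by positivity), ← ENNReal.ofReal_pow (by positivity),
        ← ENNReal.ofReal_pow (by positivity), ← ENNReal.ofReal_add (by positivity) (by positivity),
        ← ENNReal.ofReal_ofNat 2, ← ENNReal.ofReal_mul (by norm_num)]
      exact ENNReal.ofReal_le_ofReal add_sq_le

/-- Tonelli's theorem on the region `s < σ`. -/
theorem lintegral_mul_lintegral_lt (μ ν : Measure ℝ) [SFinite μ] [SFinite ν] {g k : ℝ → ℝ≥0∞}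
    (hg : AEMeasurable g μ) (hk : AEMeasurable k ν) :
    ∫⁻ s, g s * (∫⁻ σ in Ioi s, k σ ∂ν) ∂μ = ∫⁻ σ, k σ * (∫⁻ s in Iio σ, g s ∂μ) ∂ν := by
  have hR : MeasurableSet {p : ℝ × ℝ | p.1 < p.2} := measurableSet_lt measurable_fst measurable_snd
  have h1 : ∀ s, g s * (∫⁻ σ in Ioi s, k σ ∂ν)
      = ∫⁻ σ, {p : ℝ × ℝ | p.1 < p.2}.indicator (fun p => g p.1 * k p.2) (s, σ) ∂ν := by
    intro s
    rw [← lintegral_const_mul'' _ hk.restrict, ← lintegral_indicator measurableSet_Ioi]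
    rfl
  have h2 : ∀ σ, k σ * (∫⁻ s in Iio σ, g s ∂μ)
      = ∫⁻ s, {p : ℝ × ℝ | p.1 < p.2}.indicator (fun p => g p.1 * k p.2) (s, σ) ∂μ := by
    intro σ
    rw [← lintegral_const_mul'' _ hg.restrict, ← lintegral_indicator measurableSet_Iio]
    refine lintegral_congr fun s => ?_
    simp only [indicator, mem_Iio, mem_ofPred_eq, mul_comm]
  simp_rw [h1, h2]
  apply lintegral_lintegral_swap
  exact (AEMeasurable.mul (hg.comp_fst) (hk.comp_snd)).indicator hR

/-! ### Hardy inequalities on the half-line -/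

section Hardy

theorem aemeasurable_enorm_sq {E : Type*} [NormedAddCommGroup E] {h : ℝ → E} {S : Set ℝ}
    (hS : MeasurableSet S) (hc : ContinuousOn h S) :
    AEMeasurable (fun s => ‖h s‖ₑ ^ 2) (volume.restrict S) :=
  ((continuous_enorm.comp_continuousOn hc).aemeasurable hS).pow_const 2

variable {E : Type*} [NormedAddCommGroup E] [NormedSpace ℝ E] {h h' : ℝ → E}

/-- The fundamental theorem of calculus combined with the Cauchy–Schwarz inequality for an
arbitrary positive weight `w`. -/
theorem enorm_sub_sq_le [CompleteSpace E] (hd : ∀ s, 0 < s → HasDerivAt h (h' s) s)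
    (hc : ContinuousOn h' (Ioi 0)) {w : ℝ → ℝ} (hw : ∀ s, 0 < s → 0 < w s)
    (hwc : ContinuousOn w (Ioi 0)) {s S : ℝ} (hs : 0 < s) (hsS : s ≤ S) :
    ‖h S - h s‖ₑ ^ 2 ≤ (∫⁻ σ in Ioc s S, ENNReal.ofReal (w σ) * ‖h' σ‖ₑ ^ 2) *
      ∫⁻ σ in Ioc s S, ENNReal.ofReal ((w σ)⁻¹) := by
  have hsub : Ioc s S ⊆ Ioi 0 := fun x hx => hs.trans hx.1
  have hint : ∫ σ in s..S, h' σ = h S - h s := by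
    apply intervalIntegral.integral_eq_sub_of_hasDerivAt
    · intro x hx
      rw [uIcc_of_le hsS] at hx
      exact hd x (hs.trans_le hx.1)
    · apply (hc.mono _).intervalIntegrable
      rw [uIcc_of_le hsS]
      exact fun x hx => hs.trans_le hx.1
  have hsq : ContinuousOn (fun σ => √(w σ)) (Ioi 0) := hwc.sqrt
  rw [← hint, intervalIntegral.integral_of_le hsS]
  calc ‖∫ σ in Ioc s S, h' σ‖ₑ ^ 2 ≤ (∫⁻ σ in Ioc s S, ‖h' σ‖ₑ) ^ 2 := by
        gcongr; exact enorm_integral_le_lintegral_enorm _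
    _ = (∫⁻ σ in Ioc s S, (ENNReal.ofReal (√(w σ)) * ‖h' σ‖ₑ) * ENNReal.ofReal ((√(w σ))⁻¹)) ^ 2 := by
        congr 1
        refine setLIntegral_congr_fun measurableSet_Ioc fun σ hσ => ?_
        have h0 : 0 < √(w σ) := Real.sqrt_pos.2 (hw σ (hsub hσ))
        rw [mul_right_comm, ← ENNReal.ofReal_mul h0.le, mul_inv_cancel₀ h0.ne', ENNReal.ofReal_one,
          one_mul]
    _ ≤ _ := by
        refine (lintegral_mul_sq_le _ ?_ ?_).trans (le_of_eq ?_)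
        · exact ((hsq.mono hsub).aemeasurable measurableSet_Ioc).ennreal_ofReal.mul
            ((continuous_enorm.comp_continuousOn (hc.mono hsub)).aemeasurable measurableSet_Ioc)
        · exact ((hsq.mono hsub).aemeasurable measurableSet_Ioc).inv.ennreal_ofReal
        · congr 1
          · refine setLIntegral_congr_fun measurableSet_Ioc fun σ hσ => ?_
            rw [mul_pow, ← ENNReal.ofReal_pow (Real.sqrt_nonneg _),
              Real.sq_sqrt (hw σ (hsub hσ)).le]
          · refine setLIntegral_congr_fun measurableSet_Ioc fun σ hσ => ?_
            rw [← ENNReal.ofReal_pow (by positivity), inv_pow, Real.sq_sqrt (hw σ (hsub hσ)).le]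

theorem lintegral_Ioi_inv_sq {s : ℝ} (hs : 0 < s) :
    ∫⁻ σ in Ioi s, ENNReal.ofReal ((σ ^ 2)⁻¹) = ENNReal.ofReal s⁻¹ := by
  have h1 : ∀ σ ∈ Ioi s, (σ ^ 2)⁻¹ = σ ^ (-2 : ℝ) := fun σ hσ => by
    rw [Real.rpow_neg (hs.trans hσ).le, Real.rpow_two]
  have h2 := integrableOn_Ioi_rpow_of_lt (a := -2) (by norm_num) hs
  have h3 := integral_Ioi_rpow_of_lt (a := -2) (by norm_num) hs
  rw [setLIntegral_congr_fun measurableSet_Ioi (fun σ hσ => by rw [h1 σ hσ]),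
    ← ofReal_integral_eq_lintegral_ofReal h2, h3]
  · congr 1
    norm_num
    rw [Real.rpow_neg_one]
  · filter_upwards [ae_restrict_mem measurableSet_Ioi] with σ hσ
    exact Real.rpow_nonneg (hs.trans hσ).le _

/-- A Hardy inequality for functions that vanish at infinity. -/
theorem hardy_of_tendsto_zero [CompleteSpace E] (hd : ∀ s, 0 < s → HasDerivAt h (h' s) s)
    (hc : ContinuousOn h' (Ioi 0)) (hlim : Filter.Tendsto h Filter.atTop (nhds 0))
    {c : ℝ} (hc0 : 0 ≤ c) :
    ∫⁻ s in Ioi (0 : ℝ), ENNReal.ofReal (s * Real.exp (c * s)) * ‖h s‖ₑ ^ 2 ≤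
      ∫⁻ s in Ioi (0 : ℝ), ENNReal.ofReal (s ^ 3 * Real.exp (c * s)) * ‖h' s‖ₑ ^ 2 := by
  set k : ℝ → ℝ≥0∞ := fun σ => ENNReal.ofReal (σ ^ 2) * ‖h' σ‖ₑ ^ 2 with hk
  have hkm : AEMeasurable k (volume.restrict (Ioi 0)) :=
    (by fun_prop : Measurable fun σ : ℝ => ENNReal.ofReal (σ ^ 2)).aemeasurable.mul
      (aemeasurable_enorm_sq measurableSet_Ioi hc)
  -- The weight `σ ^ 2` is chosen so that `∫_s^∞ σ ^ (-2) dσ = 1 / s` cancels the factor `s`.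
  have key : ∀ s, 0 < s → ‖h s‖ₑ ^ 2 ≤ ENNReal.ofReal s⁻¹ * ∫⁻ σ in Ioi s, k σ := by
    intro s hs
    have hl : Filter.Tendsto (fun S => ‖h S - h s‖ₑ ^ 2) Filter.atTop (nhds (‖h s‖ₑ ^ 2)) := by
      have h1 := ENNReal.Tendsto.pow (n := 2) (hlim.sub_const (h s)).enorm
      simpa using h1
    refine le_of_tendsto hl ?_
    filter_upwards [Filter.eventually_ge_atTop s] with S hS
    refine (enorm_sub_sq_le hd hc (w := fun σ => σ ^ 2) (fun σ hσ => by positivity)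
      (by fun_prop) hs hS).trans ?_
    rw [mul_comm, ← lintegral_Ioi_inv_sq hs]
    gcongr <;> exact Ioc_subset_Ioi_self
  calc ∫⁻ s in Ioi (0 : ℝ), ENNReal.ofReal (s * Real.exp (c * s)) * ‖h s‖ₑ ^ 2
      ≤ ∫⁻ s in Ioi (0 : ℝ), ENNReal.ofReal (Real.exp (c * s)) *
          ∫⁻ σ in Ioi s, k σ ∂(volume.restrict (Ioi 0)) := by
        refine setLIntegral_mono' measurableSet_Ioi fun s hs => ?_
        rw [Measure.restrict_restrict measurableSet_Ioi, inter_eq_left.2 (Ioi_subset_Ioi (le_of_lt hs))]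
        refine (mul_le_mul_right (key s hs) _).trans (le_of_eq ?_)
        rw [← mul_assoc, ← ENNReal.ofReal_mul (mul_nonneg (le_of_lt hs) (Real.exp_nonneg _))]
        congr 2
        field_simp [(show s ≠ 0 from ne_of_gt hs)]
    _ = ∫⁻ σ in Ioi (0 : ℝ), k σ * ∫⁻ s in Iio σ, ENNReal.ofReal (Real.exp (c * s))
          ∂(volume.restrict (Ioi 0)) :=
        lintegral_mul_lintegral_lt _ _ (by fun_prop) hkm
    _ ≤ _ := by
        refine setLIntegral_mono' measurableSet_Ioi fun σ hσ => ?_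
        have hσ' : (0 : ℝ) < σ := hσ
        have h1 : ∫⁻ s in Iio σ, ENNReal.ofReal (Real.exp (c * s)) ∂(volume.restrict (Ioi 0))
            ≤ ENNReal.ofReal (Real.exp (c * σ)) * ENNReal.ofReal σ := by
          rw [Measure.restrict_restrict measurableSet_Iio]
          calc _ ≤ ∫⁻ s in Iio σ ∩ Ioi 0, ENNReal.ofReal (Real.exp (c * σ)) := by
                refine setLIntegral_mono' (measurableSet_Iio.inter measurableSet_Ioi) fun s hs => ?_
                have : s < σ := hs.1
                gcongr
            _ = _ := by
                rw [setLIntegral_const, inter_comm, Ioi_inter_Iio, Real.volume_Ioo, sub_zero]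
        refine (mul_le_mul_right h1 _).trans (le_of_eq ?_)
        rw [hk]
        simp only
        rw [mul_right_comm, ← ENNReal.ofReal_mul (Real.exp_nonneg _),
          ← ENNReal.ofReal_mul (by positivity)]
        congr 2
        ring

theorem lintegral_Ioc_of_hasDerivAt {F f : ℝ → ℝ} {a b : ℝ} (hab : a ≤ b)
    (hF : ∀ x, HasDerivAt F (f x) x) (hf : Continuous f) (hf0 : ∀ x ∈ Ioc a b, 0 ≤ f x) :
    ∫⁻ x in Ioc a b, ENNReal.ofReal (f x) = ENNReal.ofReal (F b - F a) := by
  rw [← ofReal_integral_eq_lintegral_ofReal, ← intervalIntegral.integral_of_le hab,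
    intervalIntegral.integral_eq_sub_of_hasDerivAt (fun x _ => hF x) (hf.intervalIntegrable _ _)]
  · exact hf.integrableOn_Ioc
  · filter_upwards [ae_restrict_mem measurableSet_Ioc] with x hx using hf0 x hx

theorem lintegral_Ioi_of_hasDerivAt {F f : ℝ → ℝ} {a l : ℝ}
    (hF : ∀ x, HasDerivAt F (f x) x) (hf0 : ∀ x ∈ Ioi a, 0 ≤ f x)
    (hl : Filter.Tendsto F Filter.atTop (nhds l)) :
    ∫⁻ x in Ioi a, ENNReal.ofReal (f x) = ENNReal.ofReal (l - F a) := by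
  rw [← ofReal_integral_eq_lintegral_ofReal,
    integral_Ioi_of_hasDerivAt_of_nonneg' (fun x _ => hF x) hf0 hl]
  · exact integrableOn_Ioi_deriv_of_nonneg' (fun x _ => hF x) hf0 hl
  · filter_upwards [ae_restrict_mem measurableSet_Ioi] with x hx using hf0 x hx

/-- The part of `hardy_sub_apply_inv` near the origin, where `e ^ (-N s)` is bounded below and
may be ignored. -/
theorem hardy_near_zero [CompleteSpace E] (hd : ∀ s, 0 < s → HasDerivAt h (h' s) s)
    (hc : ContinuousOn h' (Ioi 0)) {N : ℝ} (hN : 0 < N) :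
    ∫⁻ s in Ioc 0 N⁻¹, ENNReal.ofReal (s * Real.exp (-N * s)) * ‖h s - h N⁻¹‖ₑ ^ 2 ≤
      12 * ∫⁻ s in Ioc 0 N⁻¹, ENNReal.ofReal (s ^ 3 * Real.exp (-N * s)) * ‖h' s‖ₑ ^ 2 := by
  set k : ℝ → ℝ≥0∞ := fun σ => ENNReal.ofReal (σ ^ 2) * ‖h' σ‖ₑ ^ 2 with hk
  have hkm : AEMeasurable k (volume.restrict (Ioc 0 N⁻¹)) :=
    (by fun_prop : Measurable fun σ : ℝ => ENNReal.ofReal (σ ^ 2)).aemeasurable.mul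
      (aemeasurable_enorm_sq measurableSet_Ioc (hc.mono Ioc_subset_Ioi_self))
  have key : ∀ s ∈ Ioc 0 N⁻¹, ‖h s - h N⁻¹‖ₑ ^ 2 ≤
      ENNReal.ofReal s⁻¹ * ∫⁻ σ in Ioc s N⁻¹, k σ := by
    intro s hs
    rw [← enorm_neg, neg_sub]
    refine (enorm_sub_sq_le hd hc (w := fun σ => σ ^ 2) (fun σ hσ => by positivity)
      (by fun_prop) hs.1 hs.2).trans ?_
    rw [mul_comm, ← lintegral_Ioi_inv_sq hs.1]
    gcongr
    exact Ioc_subset_Ioi_self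
  rw [← lintegral_const_mul' _ _ (by simp)]
  calc _ ≤ ∫⁻ s in Ioc 0 N⁻¹, 1 * ∫⁻ σ in Ioi s, k σ ∂(volume.restrict (Ioc 0 N⁻¹)) := by
        refine setLIntegral_mono' measurableSet_Ioc fun s hs => ?_
        have hI : Ioi s ∩ Ioc 0 N⁻¹ = Ioc s N⁻¹ := by
          ext x
          simp only [mem_inter_iff, mem_Ioi, mem_Ioc]
          exact ⟨fun h => ⟨h.1, h.2.2⟩, fun h => ⟨h.1, hs.1.trans h.1, h.2⟩⟩
        rw [Measure.restrict_restrict measurableSet_Ioi, hI]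
        refine (mul_le_mul_right (key s hs) _).trans ?_
        rw [← mul_assoc, ← ENNReal.ofReal_mul (mul_nonneg hs.1.le (Real.exp_nonneg _))]
        gcongr
        rw [ENNReal.ofReal_le_one, mul_right_comm, mul_inv_cancel₀ hs.1.ne', one_mul,
          Real.exp_le_one_iff]
        nlinarith [hs.1]
    _ = ∫⁻ σ in Ioc 0 N⁻¹, k σ * ∫⁻ s in Iio σ, 1 ∂(volume.restrict (Ioc 0 N⁻¹)) :=
        lintegral_mul_lintegral_lt _ _ (by fun_prop) hkm
    _ ≤ _ := by
        refine setLIntegral_mono' measurableSet_Ioc fun σ hσ => ?_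
        have h1 : ∫⁻ s in Iio σ, 1 ∂(volume.restrict (Ioc 0 N⁻¹)) ≤ ENNReal.ofReal σ := by
          rw [Measure.restrict_restrict measurableSet_Iio, setLIntegral_one]
          refine (measure_mono (t := Ioc 0 σ) fun x hx => ⟨hx.2.1, le_of_lt hx.1⟩).trans ?_
          simp
        refine (mul_le_mul_right h1 _).trans ?_
        rw [hk]
        simp only
        rw [mul_right_comm, ← ENNReal.ofReal_mul (by positivity),
          ← ENNReal.ofReal_ofNat 12, ← mul_assoc (ENNReal.ofReal _), ← ENNReal.ofReal_mul (by norm_num)]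
        refine mul_le_mul_left (ENNReal.ofReal_le_ofReal ?_) _
        have h2 : N * σ ≤ 1 := by
          have := mul_le_mul_of_nonneg_left hσ.2 hN.le
          rwa [mul_inv_cancel₀ hN.ne'] at this
        have h3 : Real.exp (-1) ≤ Real.exp (-N * σ) := Real.exp_le_exp.2 (by linarith)
        -- `e ^ (-N σ) ≥ e⁻¹ ≥ 1 / 12` on the interval of integration; `12` is shared with the part
        -- near infinity.
        have h4 : (1 : ℝ) / 12 ≤ Real.exp (-1) := by
          rw [Real.exp_neg, one_div]
          exact inv_anti₀ (Real.exp_pos _) (by linarith [Real.exp_one_lt_d9])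
        have h5 : 0 < σ ^ 3 := pow_pos hσ.1 3
        have h6 : σ ^ 2 * σ = σ ^ 3 := by ring
        nlinarith

/-- The primitive of `s e ^ (-c s / 2)` vanishes at infinity. -/
theorem tendsto_exp_neg_mul {c : ℝ} (hc : 0 < c) :
    Filter.Tendsto (fun s : ℝ => (2 * s / c + 4 / c ^ 2) * -Real.exp (-c * s / 2)) Filter.atTop
      (nhds 0) := by
  have h1 := (tendsto_rpow_mul_exp_neg_mul_atTop_nhds_zero 1 (c / 2) (by positivity)).const_mul
    (-(2 / c))
  have h0 := (tendsto_rpow_mul_exp_neg_mul_atTop_nhds_zero 0 (c / 2) (by positivity)).const_mul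
    (-(4 / c ^ 2))
  have := h1.add h0
  simp only [Real.rpow_one, Real.rpow_zero, mul_zero, add_zero] at this
  refine this.congr fun s => ?_
  rw [show -c * s / 2 = -(c / 2) * s by ring]
  ring

/-- The part of `hardy_sub_apply_inv` near infinity. The weight `e ^ (-N σ / 2)` in the
Cauchy–Schwarz inequality leaves exponential decay for both integrations. -/
theorem hardy_near_infinity [CompleteSpace E] (hd : ∀ s, 0 < s → HasDerivAt h (h' s) s)
    (hc : ContinuousOn h' (Ioi 0)) {N : ℝ} (hN : 0 < N) :
    ∫⁻ s in Ioi N⁻¹, ENNReal.ofReal (s * Real.exp (-N * s)) * ‖h s - h N⁻¹‖ₑ ^ 2 ≤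
      12 * ∫⁻ s in Ioi N⁻¹, ENNReal.ofReal (s ^ 3 * Real.exp (-N * s)) * ‖h' s‖ₑ ^ 2 := by
  have hN' : 0 < N⁻¹ := inv_pos.2 hN
  have hsub : Ioi N⁻¹ ⊆ Ioi 0 := Ioi_subset_Ioi hN'.le
  set k : ℝ → ℝ≥0∞ := fun σ => ENNReal.ofReal (Real.exp (-N * σ / 2)) * ‖h' σ‖ₑ ^ 2 with hk
  have hkm : AEMeasurable k (volume.restrict (Ioi N⁻¹)) :=
    (by fun_prop : Measurable fun σ : ℝ => ENNReal.ofReal (Real.exp (-N * σ / 2))).aemeasurable.mul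
      (aemeasurable_enorm_sq measurableSet_Ioi (hc.mono hsub))
  have key : ∀ s ∈ Ioi N⁻¹, ‖h s - h N⁻¹‖ₑ ^ 2 ≤
      ENNReal.ofReal (2 / N * Real.exp (N * s / 2)) * ∫⁻ σ in Ioc N⁻¹ s, k σ := by
    intro s hs
    refine (enorm_sub_sq_le hd hc (w := fun σ => Real.exp (-N * σ / 2))
      (fun σ hσ => Real.exp_pos _) (by fun_prop) hN' (le_of_lt hs)).trans ?_
    rw [mul_comm]
    refine mul_le_mul_left ?_ _
    have h1 : ∀ x : ℝ, HasDerivAt (fun x => 2 / N * Real.exp (N * x / 2)) (Real.exp (N * x / 2)) x := by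
      intro x
      have := ((((hasDerivAt_id x).const_mul N).div_const 2).exp).const_mul (2 / N)
      convert! this using 1
      simp only [id]
      field_simp
    calc _ = ∫⁻ σ in Ioc N⁻¹ s, ENNReal.ofReal (Real.exp (N * σ / 2)) := by
          refine lintegral_congr fun σ => ?_
          rw [← Real.exp_neg]
          congr 2
          ring
      _ = _ := lintegral_Ioc_of_hasDerivAt (le_of_lt hs) h1 (by fun_prop)
          fun x _ => Real.exp_nonneg _
      _ ≤ _ := by
          apply ENNReal.ofReal_le_ofReal
          have : 0 ≤ 2 / N * Real.exp (N * N⁻¹ / 2) := by positivity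
          linarith
  rw [← lintegral_const_mul' _ _ (by simp)]
  set g : ℝ → ℝ≥0∞ := fun s => ENNReal.ofReal (2 / N * (s * Real.exp (-N * s / 2))) with hg
  calc _ ≤ ∫⁻ s in Ioi N⁻¹, g s * ∫⁻ σ in Iio s, k σ ∂(volume.restrict (Ioi N⁻¹)) := by
        refine setLIntegral_mono' measurableSet_Ioi fun s hs => ?_
        have hs0 : 0 < s := hN'.trans hs
        rw [Measure.restrict_restrict measurableSet_Iio, Iio_inter_Ioi,
          setLIntegral_congr Ioo_ae_eq_Ioc]
        refine (mul_le_mul_right (key s hs) _).trans (le_of_eq ?_)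
        rw [← mul_assoc, ← ENNReal.ofReal_mul (by positivity), hg]
        congr 2
        rw [show -N * s / 2 = -N * s + N * s / 2 by ring, Real.exp_add]
        ring
    _ = ∫⁻ σ in Ioi N⁻¹, k σ * ∫⁻ s in Ioi σ, g s ∂(volume.restrict (Ioi N⁻¹)) :=
        (lintegral_mul_lintegral_lt _ _ hkm (by fun_prop)).symm
    _ ≤ _ := by
        refine setLIntegral_mono' measurableSet_Ioi fun σ hσ => ?_
        have hσ1 : N⁻¹ < σ := hσ
        have hσ0 : 0 < σ := hN'.trans hσ
        have h1 : ∀ x : ℝ, HasDerivAt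
            (fun x => 2 / N * ((2 * x / N + 4 / N ^ 2) * -Real.exp (-N * x / 2)))
            (2 / N * (x * Real.exp (-N * x / 2))) x := by
          intro x
          have e := ((((hasDerivAt_id x).const_mul (-N)).div_const 2).exp).neg
          have l := (((hasDerivAt_id x).const_mul 2).div_const N).add_const (4 / N ^ 2)
          have := (l.mul e).const_mul (2 / N)
          convert! this using 1
          simp only [id, Pi.neg_apply]
          field_simp
          ring
        have h2 : ∫⁻ s in Ioi σ, g s = ENNReal.ofReal
            (2 / N * ((2 * σ / N + 4 / N ^ 2) * Real.exp (-N * σ / 2))) := by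
          rw [hg, lintegral_Ioi_of_hasDerivAt h1
            (fun x hx => by have : 0 < x := hσ0.trans hx
                            positivity)
            (by simpa using (tendsto_exp_neg_mul hN).const_mul (2 / N))]
          congr 1
          ring
        rw [Measure.restrict_restrict measurableSet_Ioi, inter_eq_left.2 (Ioi_subset_Ioi hσ1.le),
          h2, hk]
        simp only
        rw [mul_right_comm, ← ENNReal.ofReal_mul (by positivity),
          ← ENNReal.ofReal_ofNat 12, ← mul_assoc (ENNReal.ofReal _), ← ENNReal.ofReal_mul (by norm_num)]
        refine mul_le_mul_left (ENNReal.ofReal_le_ofReal ?_) _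
        have h0 : Real.exp (-N * σ) = Real.exp (-N * σ / 2) * Real.exp (-N * σ / 2) := by
          rw [← Real.exp_add]
          congr 1
          ring
        rw [h0]
        have h3 : 2 / N * (2 * σ / N + 4 / N ^ 2) ≤ 12 * σ ^ 3 := by
          have : 2 / N * (2 * σ / N + 4 / N ^ 2) = 4 * σ * (N⁻¹) ^ 2 + 8 * (N⁻¹) ^ 3 := by
            field_simp
            ring
          rw [this]
          have h4 : (N⁻¹) ^ 2 ≤ σ ^ 2 := by gcongr
          have h5 : (N⁻¹) ^ 3 ≤ σ ^ 3 := by gcongr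
          nlinarith
        have h6 : 0 ≤ Real.exp (-N * σ / 2) * Real.exp (-N * σ / 2) := by positivity
        nlinarith

/-- A Hardy inequality for the deviation of `h` from its value at `1 / N`. -/
theorem hardy_sub_apply_inv [CompleteSpace E] (hd : ∀ s, 0 < s → HasDerivAt h (h' s) s)
    (hc : ContinuousOn h' (Ioi 0)) {N : ℝ} (hN : 0 < N) :
    ∫⁻ s in Ioi (0 : ℝ), ENNReal.ofReal (s * Real.exp (-N * s)) * ‖h s - h N⁻¹‖ₑ ^ 2 ≤
      12 * ∫⁻ s in Ioi (0 : ℝ), ENNReal.ofReal (s ^ 3 * Real.exp (-N * s)) * ‖h' s‖ₑ ^ 2 := by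
  have hU : Ioi (0 : ℝ) = Ioc 0 N⁻¹ ∪ Ioi N⁻¹ := (Ioc_union_Ioi_eq_Ioi (inv_pos.2 hN).le).symm
  have hdis : Disjoint (Ioc 0 N⁻¹) (Ioi N⁻¹) := Ioc_disjoint_Ioi le_rfl
  rw [hU, lintegral_union measurableSet_Ioi hdis, lintegral_union measurableSet_Ioi hdis, mul_add]
  exact add_le_add (hardy_near_zero hd hc hN) (hardy_near_infinity hd hc hN)

theorem integrableOn_rpow_mul_exp_neg_mul {a N : ℝ} (ha : 0 < a) (hN : 0 < N) :
    IntegrableOn (fun s : ℝ => s ^ (a - 1) * Real.exp (-(N * s))) (Ioi 0) := by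
  refine not_imp_comm.1 integral_undef ?_
  rw [Real.integral_rpow_mul_exp_neg_mul_Ioi ha hN]
  have := Real.Gamma_pos_of_pos ha
  positivity

theorem lintegral_rpow_mul_exp_neg_mul {a N : ℝ} (ha : 0 < a) (hN : 0 < N) :
    ∫⁻ s in Ioi (0 : ℝ), ENNReal.ofReal (s ^ (a - 1) * Real.exp (-(N * s))) =
      ENNReal.ofReal ((1 / N) ^ a * Real.Gamma a) := by
  rw [← ofReal_integral_eq_lintegral_ofReal (integrableOn_rpow_mul_exp_neg_mul ha hN),
    Real.integral_rpow_mul_exp_neg_mul_Ioi ha hN]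
  filter_upwards [ae_restrict_mem measurableSet_Ioi] with s hs
  have : (0 : ℝ) < s := hs
  positivity

theorem inv_one_sub_exp_neg_le {s : ℝ} (hs : 0 < s) : (1 - Real.exp (-s))⁻¹ ≤ 1 + s⁻¹ := by
  have h1 : Real.exp (-s) ≤ (1 + s)⁻¹ := by
    rw [Real.exp_neg]
    exact inv_anti₀ (by linarith) (by linarith [Real.add_one_le_exp s])
  have h2 : (1 + s⁻¹)⁻¹ ≤ 1 - Real.exp (-s) := by
    have : (1 + s⁻¹)⁻¹ = 1 - (1 + s)⁻¹ := by field_simp; ring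
    linarith
  exact inv_le_of_inv_le₀ (by positivity) h2

/-- Cauchy–Schwarz for the averages `∫ s ^ α e ^ (-N s) k(s) ds`. This is where `0 < α` is needed:
the integral of `s ^ (2 α - 1)` converges at the origin. -/
theorem enorm_integral_rpow_mul_exp_sq_le {α N : ℝ} (hα : 0 < α) (hN : 1 ≤ N) {k : ℝ → E}
    (hk : ContinuousOn k (Ioi 0)) :
    ‖∫ s in Ioi (0 : ℝ), (s ^ α * Real.exp (-N * s)) • k s‖ₑ ^ 2 ≤
      ENNReal.ofReal ((Real.Gamma (2 * α + 1) + Real.Gamma (2 * α)) * N ^ (-(2 * α))) *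
        ∫⁻ s in Ioi (0 : ℝ), ENNReal.ofReal ((1 - Real.exp (-s)) * Real.exp (-N * s)) *
          ‖k s‖ₑ ^ 2 := by
  have hN0 : 0 < N := by linarith
  set W : ℝ → ℝ := fun s => (1 - Real.exp (-s)) * Real.exp (-N * s) with hW
  have hWpos : ∀ s, 0 < s → 0 < W s := fun s hs =>
    mul_pos (by linarith [Real.exp_lt_one_iff.2 (neg_lt_zero.2 hs)]) (Real.exp_pos _)
  calc ‖∫ s in Ioi (0 : ℝ), (s ^ α * Real.exp (-N * s)) • k s‖ₑ ^ 2
      ≤ (∫⁻ s in Ioi (0 : ℝ), ‖(s ^ α * Real.exp (-N * s)) • k s‖ₑ) ^ 2 := by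
        gcongr; exact enorm_integral_le_lintegral_enorm _
    _ = (∫⁻ s in Ioi (0 : ℝ), ENNReal.ofReal (s ^ α * Real.exp (-N * s) * (√(W s))⁻¹) *
          (ENNReal.ofReal √(W s) * ‖k s‖ₑ)) ^ 2 := by
        congr 1
        refine setLIntegral_congr_fun measurableSet_Ioi fun s hs => ?_
        have hs0 : (0 : ℝ) < s := hs
        have h0 : 0 < √(W s) := Real.sqrt_pos.2 (hWpos s hs0)
        rw [enorm_smul, ← mul_assoc, ← ENNReal.ofReal_mul (by positivity), mul_assoc _ _ √(W s),
          inv_mul_cancel₀ h0.ne', mul_one, Real.enorm_of_nonneg (by positivity)]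
    _ ≤ _ := by
        refine (lintegral_mul_sq_le _ (by fun_prop) ?_).trans ?_
        · exact (by fun_prop : Measurable fun s => ENNReal.ofReal √(W s)).aemeasurable.mul
            ((continuous_enorm.comp_continuousOn hk).aemeasurable measurableSet_Ioi)
        refine mul_le_mul' ?_ (le_of_eq ?_)
        · calc _ ≤ ∫⁻ s in Ioi (0 : ℝ),
                (ENNReal.ofReal (s ^ (2 * α + 1 - 1) * Real.exp (-(N * s))) +
                  ENNReal.ofReal (s ^ (2 * α - 1) * Real.exp (-(N * s)))) := by
                refine setLIntegral_mono' measurableSet_Ioi fun s hs => ?_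
                have hs0 : (0 : ℝ) < s := hs
                rw [← ENNReal.ofReal_pow (by positivity),
                  ← ENNReal.ofReal_add (by positivity) (by positivity)]
                apply ENNReal.ofReal_le_ofReal
                have h1 : (s ^ α) ^ 2 = s ^ (2 * α) := by
                  rw [← Real.rpow_natCast, ← Real.rpow_mul hs0.le]
                  congr 1; push_cast; ring
                have h2 : s ^ (2 * α - 1) = s ^ (2 * α) * s⁻¹ := by
                  rw [Real.rpow_sub hs0, Real.rpow_one, div_eq_mul_inv]
                have he : Real.exp (-N * s) * (Real.exp (-N * s))⁻¹ = 1 :=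
                  mul_inv_cancel₀ (Real.exp_pos _).ne'
                rw [mul_pow, mul_pow, inv_pow, Real.sq_sqrt (hWpos s hs0).le, h1, h2, hW]
                simp only [add_sub_cancel_right, mul_inv]
                rw [← neg_mul]
                have h3 := inv_one_sub_exp_neg_le hs0
                calc _ = s ^ (2 * α) * Real.exp (-N * s) * (1 - Real.exp (-s))⁻¹ *
                      (Real.exp (-N * s) * (Real.exp (-N * s))⁻¹) := by ring
                  _ ≤ s ^ (2 * α) * Real.exp (-N * s) * (1 + s⁻¹) := by
                      rw [he, mul_one]; gcongr
                  _ = _ := by ring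
            _ = ENNReal.ofReal ((1 / N) ^ (2 * α + 1) * Real.Gamma (2 * α + 1)) +
                  ENNReal.ofReal ((1 / N) ^ (2 * α) * Real.Gamma (2 * α)) := by
                rw [lintegral_add_left (by fun_prop),
                  lintegral_rpow_mul_exp_neg_mul (by positivity) hN0,
                  lintegral_rpow_mul_exp_neg_mul (by positivity) hN0]
            _ ≤ _ := by
                have g1 := Real.Gamma_pos_of_pos (show 0 < 2 * α + 1 by positivity)
                have g2 := Real.Gamma_pos_of_pos (show 0 < 2 * α by positivity)
                rw [← ENNReal.ofReal_add (by positivity) (by positivity)]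
                apply ENNReal.ofReal_le_ofReal
                have h1 : (1 / N) ^ (2 * α) = N ^ (-(2 * α)) := by
                  rw [one_div, Real.inv_rpow hN0.le, Real.rpow_neg hN0.le]
                have h2 : (1 / N) ^ (2 * α + 1) ≤ (1 / N) ^ (2 * α) :=
                  Real.rpow_le_rpow_of_exponent_ge (by positivity)
                    (by rw [one_div]; exact inv_le_one_of_one_le₀ hN) (by linarith)
                rw [← h1]
                nlinarith
        · refine setLIntegral_congr_fun measurableSet_Ioi fun s hs => ?_
          have hs0 : (0 : ℝ) < s := hs
          rw [mul_pow, ← ENNReal.ofReal_pow (by positivity), Real.sq_sqrt (hWpos s hs0).le]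

end Hardy

/-! ### Growth and decay of coefficient sequences -/

section Growth

variable {Y : Type*} [NormedAddCommGroup Y]

/-- Sequences of at most subexponential growth: the Taylor coefficients of the functions that are
analytic on the open unit disc. -/
def SubExp (u : ℕ → Y) : Prop :=
  ∀ r : ℝ, 0 < r → r < 1 → Summable fun n => ‖u n‖ * r ^ n

/-- Exponentially decaying sequences: the Taylor coefficients of the functions that are analytic
on a disc of radius larger than one. -/
def ExpDecay (c : ℕ → Y) : Prop :=
  ∃ R : ℝ, 1 < R ∧ Summable fun n => ‖c n‖ * R ^ n

theorem exists_le_sq {ρ : ℝ} (h : ρ < 1) : ∃ q : ℝ, 0 < q ∧ q < 1 ∧ ρ ≤ q * q := by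
  set t := max ((1 + ρ) / 2) (1 / 2) with ht
  have h0 : 0 < t := lt_max_of_lt_right (by norm_num)
  have h1 : t < 1 := max_lt (by linarith) (by norm_num)
  refine ⟨√t, Real.sqrt_pos.2 h0, (Real.sqrt_lt' one_pos).2 (by simpa using h1), ?_⟩
  rw [Real.mul_self_sqrt h0.le]
  exact le_trans (by linarith) (le_max_left _ _)

theorem summable_rpow_mul_geometric (β : ℝ) {q : ℝ} (h0 : 0 < q) (h1 : q < 1) :
    Summable fun n : ℕ => (1 + (n : ℝ)) ^ β * q ^ n := by
  have h := (summable_nat_add_iff 1).2 (summable_pow_mul_geometric_of_norm_lt_one ⌈β⌉₊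
    (r := q) (by rwa [Real.norm_of_nonneg h0.le]))
  refine Summable.of_nonneg_of_le (fun n => by positivity) (fun n => ?_) (h.mul_left q⁻¹)
  have h2 : (1 + (n : ℝ)) ^ β ≤ (1 + (n : ℝ)) ^ ⌈β⌉₊ := by
    rw [← Real.rpow_natCast]
    exact Real.rpow_le_rpow_of_exponent_le (by linarith [Nat.cast_nonneg (α := ℝ) n])
      (Nat.le_ceil β)
  calc (1 + (n : ℝ)) ^ β * q ^ n ≤ (1 + (n : ℝ)) ^ ⌈β⌉₊ * q ^ n := by gcongr
    _ = _ := by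
      push_cast
      rw [pow_succ, add_comm (1 : ℝ)]
      field_simp

theorem SubExp.exists_bound {u : ℕ → Y} (hu : SubExp u) {r : ℝ} (h0 : 0 < r) (h1 : r < 1) :
    ∃ K : ℝ, 0 ≤ K ∧ ∀ n, ‖u n‖ * r ^ n ≤ K :=
  ⟨_, tsum_nonneg fun n => by positivity,
    fun n => (hu r h0 h1).le_tsum n fun m _ => by positivity⟩

theorem SubExp.of_norm_le {Z : Type*} [NormedAddCommGroup Z] {u : ℕ → Y} {v : ℕ → Z}
    (hu : SubExp u) (β : ℝ) (h : ∀ n, ‖v n‖ ≤ (1 + (n : ℝ)) ^ β * ‖u n‖) : SubExp v := by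
  intro r h0 h1
  -- One factor `q ^ n` absorbs the growth of `u`, the other one the power of `1 + n`.
  obtain ⟨q, hq0, hq1, hq⟩ := exists_le_sq h1
  obtain ⟨K, hK, hb⟩ := hu.exists_bound hq0 hq1
  refine Summable.of_nonneg_of_le (fun n => by positivity) (fun n => ?_)
    ((summable_rpow_mul_geometric β hq0 hq1).mul_left K)
  calc ‖v n‖ * r ^ n ≤ ((1 + (n : ℝ)) ^ β * ‖u n‖) * (q * q) ^ n := by
        gcongr
        exact h n
    _ = (‖u n‖ * q ^ n) * ((1 + (n : ℝ)) ^ β * q ^ n) := by rw [mul_pow]; ring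
    _ ≤ K * ((1 + (n : ℝ)) ^ β * q ^ n) := by gcongr; exact hb n

theorem ExpDecay.of_norm_le {Z : Type*} [NormedAddCommGroup Z] {c : ℕ → Y} {d : ℕ → Z}
    (hc : ExpDecay c) (β : ℝ) (h : ∀ n, ‖d n‖ ≤ (1 + (n : ℝ)) ^ β * ‖c n‖) : ExpDecay d := by
  obtain ⟨R, hR, hs⟩ := hc
  have hR0 : 0 < R := one_pos.trans hR
  obtain ⟨q, hq0, hq1, hq⟩ := exists_le_sq (inv_lt_one_of_one_lt₀ hR)
  have hK : ∀ n, ‖c n‖ * R ^ n ≤ ∑' n, ‖c n‖ * R ^ n :=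
    fun n => hs.le_tsum n fun m _ => by positivity
  refine ⟨q⁻¹, (one_lt_inv₀ hq0).2 hq1, ?_⟩
  refine Summable.of_nonneg_of_le (fun n => by positivity) (fun n => ?_)
    ((summable_rpow_mul_geometric β hq0 hq1).mul_left (∑' n, ‖c n‖ * R ^ n))
  have hqR : q⁻¹ ≤ R * q := by
    rw [inv_le_iff_one_le_mul₀ hq0]
    rw [inv_le_iff_one_le_mul₀ hR0] at hq
    linarith
  calc ‖d n‖ * q⁻¹ ^ n ≤ ((1 + (n : ℝ)) ^ β * ‖c n‖) * (R * q) ^ n := by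
        gcongr
        exact h n
    _ = (‖c n‖ * R ^ n) * ((1 + (n : ℝ)) ^ β * q ^ n) := by rw [mul_pow]; ring
    _ ≤ _ := by gcongr; exact hK n

theorem ExpDecay.summable_norm {c : ℕ → Y} (hc : ExpDecay c) : Summable fun n => ‖c n‖ := by
  obtain ⟨R, hR, hs⟩ := hc
  exact Summable.of_nonneg_of_le (fun n => norm_nonneg _)
    (fun n => le_mul_of_one_le_right (norm_nonneg _) (one_le_pow₀ hR.le)) hs

theorem ExpDecay.summable_mul_pow {c : ℕ → Y} (hc : ExpDecay c) {r : ℝ} (h0 : 0 ≤ r) (h1 : r ≤ 1) :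
    Summable fun n => ‖c n‖ * r ^ n :=
  Summable.of_nonneg_of_le (fun n => by positivity)
    (fun n => mul_le_of_le_one_right (norm_nonneg _) (pow_le_one₀ h0 h1)) hc.summable_norm

theorem expDecay_geometric [NormedSpace ℂ Y] {z : ℂ} (hz : ‖z‖ < 1) (x : Y) :
    ExpDecay fun m => z ^ m • x := by
  obtain ⟨q, hq0, hq1, hq⟩ := exists_le_sq hz
  refine ⟨q⁻¹, (one_lt_inv₀ hq0).2 hq1, ?_⟩
  refine Summable.of_nonneg_of_le (fun n => by positivity) (fun n => ?_)
    ((summable_geometric_of_lt_one hq0.le hq1).mul_left ‖x‖)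
  rw [norm_smul, norm_pow]
  calc ‖z‖ ^ n * ‖x‖ * q⁻¹ ^ n ≤ (q * q) ^ n * ‖x‖ * q⁻¹ ^ n := by gcongr
    _ = ‖x‖ * q ^ n * (q * q⁻¹) ^ n := by rw [mul_pow, mul_pow]; ring
    _ = _ := by rw [mul_inv_cancel₀ hq0.ne', one_pow, mul_one]

/-- The extension of a sequence by zero to negative indices. -/
def zeroExtend (u : ℕ → Y) (k : ℤ) : Y :=
  if 0 ≤ k then u k.toNat else 0

@[simp]
theorem zeroExtend_natCast (u : ℕ → Y) (n : ℕ) : zeroExtend u n = u n := by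
  simp [zeroExtend]

theorem zeroExtend_of_neg (u : ℕ → Y) {k : ℤ} (hk : k < 0) : zeroExtend u k = 0 := by
  simp [zeroExtend, hk]

theorem mem_range_natCast_of_zeroExtend_ne {u : ℕ → Y} {k : ℤ} (h : zeroExtend u k ≠ 0) :
    k ∈ range (Nat.cast : ℕ → ℤ) := by
  by_contra hk
  exact h (zeroExtend_of_neg u (by
    by_contra h0
    exact hk ⟨k.toNat, Int.toNat_of_nonneg (not_lt.1 h0)⟩))

theorem tsum_zpow_smul_zeroExtend [NormedSpace ℂ Y] (u : ℕ → Y) (z : ℂ) :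
    ∑' k : ℤ, z ^ k • zeroExtend u k = ∑' k : ℕ, z ^ k • u k := by
  rw [← Nat.cast_injective.tsum_eq (f := fun k : ℤ => z ^ k • zeroExtend u k)]
  · simp
  · intro k hk
    refine mem_range_natCast_of_zeroExtend_ne (u := u) fun h => hk ?_
    simp [h]

theorem SubExp.summable_zeroExtend {u : ℕ → Y} (hu : SubExp u) {r : ℝ} (h0 : 0 < r) (h1 : r < 1) :
    Summable fun k : ℤ => ‖zeroExtend u k‖ * r ^ k := by
  rw [← Nat.cast_injective.summable_iff (f := fun k : ℤ => ‖zeroExtend u k‖ * r ^ k)]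
  · simpa [Function.comp_def] using hu r h0 h1
  · intro k hk
    have : zeroExtend u k = 0 := by
      by_contra h
      exact hk (mem_range_natCast_of_zeroExtend_ne h)
    simp [this]

end Growth

/-! ### Series in powers of `e ^ (-s)` -/

section ExpSeries

variable {E : Type*} [NormedAddCommGroup E] [NormedSpace ℝ E]

/-- The power series `∑ b_m t ^ m` in the logarithmic variable `t = e ^ (-s)`. -/
noncomputable def expSeries (b : ℕ → E) (s : ℝ) : E :=
  ∑' m : ℕ, Real.exp (-(m * s)) • b m

theorem norm_exp_smul_le (b : ℕ → E) {s : ℝ} (hs : 0 ≤ s) (m : ℕ) :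
    ‖Real.exp (-(m * s)) • b m‖ ≤ ‖b m‖ := by
  rw [norm_smul, Real.norm_of_nonneg (Real.exp_nonneg _)]
  refine mul_le_of_le_one_left (norm_nonneg _) (Real.exp_le_one_iff.2 ?_)
  have : 0 ≤ (m : ℝ) * s := by positivity
  linarith

variable [CompleteSpace E] {b : ℕ → E}

theorem summable_expSeries (hb : Summable fun m => ‖b m‖) {s : ℝ} (hs : 0 ≤ s) :
    Summable fun m : ℕ => Real.exp (-(m * s)) • b m :=
  Summable.of_norm_bounded hb (norm_exp_smul_le b hs)

theorem continuousOn_expSeries (hb : Summable fun m => ‖b m‖) :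
    ContinuousOn (expSeries b) (Ioi 0) := by
  refine continuousOn_tsum (fun m => ?_) hb (fun m s hs => norm_exp_smul_le b (le_of_lt hs) m)
  exact Continuous.continuousOn (by fun_prop)

theorem hasDerivAt_expSeries (hb : Summable fun m => ‖b m‖)
    (hb' : Summable fun m : ℕ => ‖(m : ℝ) • b m‖) {s : ℝ} (hs : 0 < s) :
    HasDerivAt (expSeries b) (-expSeries (fun m : ℕ => (m : ℝ) • b m) s) s := by
  have h := hasDerivAt_tsum_of_isPreconnected (t := Ioi (0 : ℝ))
    (g := fun (m : ℕ) (s : ℝ) => Real.exp (-(m * s)) • b m)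
    (g' := fun (m : ℕ) (s : ℝ) => -(Real.exp (-(m * s)) • (m : ℝ) • b m)) hb' isOpen_Ioi
    isPreconnected_Ioi (fun m s _ => ?_)
    (fun m s hs => by rw [norm_neg]; exact norm_exp_smul_le (fun m : ℕ => (m : ℝ) • b m) (le_of_lt hs) m)
    hs (summable_expSeries hb hs.le) hs
  · rw [tsum_neg] at h
    exact h
  · have h1 := ((((hasDerivAt_id s).const_mul (m : ℝ)).neg).exp).smul_const (b m)
    convert! h1 using 1
    simp [smul_smul, neg_smul]

theorem tendsto_expSeries (hb : Summable fun m => ‖b m‖) (h0 : b 0 = 0) :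
    Filter.Tendsto (expSeries b) Filter.atTop (nhds 0) := by
  have h := tendsto_tsum_of_dominated_convergence (𝓕 := Filter.atTop)
    (f := fun (s : ℝ) (m : ℕ) => Real.exp (-(m * s)) • b m) (g := fun _ => (0 : E)) hb
    (fun m => ?_) ?_
  · simpa [expSeries] using! h
  · rcases Nat.eq_zero_or_pos m with rfl | hm
    · simp [h0]
    · have h1 : Filter.Tendsto (fun s : ℝ => Real.exp (-(m * s))) Filter.atTop (nhds 0) := by
        refine Real.tendsto_exp_neg_atTop_nhds_zero.comp ?_
        exact Filter.tendsto_id.const_mul_atTop (by exact_mod_cast hm)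
      simpa using h1.smul_const (b m)
  · filter_upwards [Filter.eventually_ge_atTop (0 : ℝ)] with s hs m using norm_exp_smul_le b hs m

end ExpSeries

/-! ### Parseval's identity for vector-valued Fourier series -/

section Parseval

variable {E : Type*} [NormedAddCommGroup E] [InnerProductSpace ℂ E] [CompleteSpace E]

theorem integral_exp_int_mul (a : ℝ) (n : ℤ) :
    ∫ θ in Ioc a (a + 2 * Real.pi), Complex.exp (n * θ * Complex.I) =
      if n = 0 then ((2 * Real.pi : ℝ) : ℂ) else 0 := by
  have hle : a ≤ a + 2 * Real.pi := by linarith [Real.pi_pos]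
  rw [← intervalIntegral.integral_of_le hle]
  split_ifs with hn
  · simp [hn]
  · have hc : (n : ℂ) * Complex.I ≠ 0 := by simp [hn]
    have h1 : ∀ θ : ℝ, (n : ℂ) * θ * Complex.I = n * Complex.I * θ := fun θ => by ring
    simp_rw [h1]
    rw [integral_exp_mul_complex hc]
    have h2 : (n : ℂ) * Complex.I * ((a + 2 * Real.pi : ℝ) : ℂ) =
        n * Complex.I * a + n * (2 * Real.pi * Complex.I) := by push_cast; ring
    rw [h2, Complex.exp_add, Complex.exp_int_mul_two_pi_mul_I, mul_one, sub_self, zero_div]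

theorem norm_exp_int_mul (n : ℤ) (θ : ℝ) : ‖Complex.exp (n * θ * Complex.I)‖ = 1 := by
  rw [show (n : ℂ) * θ * Complex.I = ((n * θ : ℝ) : ℂ) * Complex.I by push_cast; rfl]
  exact Complex.norm_exp_ofReal_mul_I _

/-- Parseval's identity for vector-valued Fourier series with summable coefficients. -/
theorem lintegral_enorm_fourier_sq (a : ℝ) {b : ℤ → E} (hb : Summable fun n => ‖b n‖) :
    ∫⁻ θ in Ioc a (a + 2 * Real.pi), ‖∑' n : ℤ, Complex.exp (n * θ * Complex.I) • b n‖ₑ ^ 2 =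
      ENNReal.ofReal (2 * Real.pi) * ∑' n : ℤ, ‖b n‖ₑ ^ 2 := by
  set μ := volume.restrict (Ioc a (a + 2 * Real.pi)) with hμ
  have hμr : μ.real univ = 2 * Real.pi := by
    simp [hμ, Measure.real, Real.pi_pos.le]
  have hnorm : ∀ (n : ℤ) (θ : ℝ), ‖Complex.exp (n * θ * Complex.I) • b n‖ = ‖b n‖ := fun n θ => by
    rw [norm_smul, norm_exp_int_mul, one_mul]
  set u : ℝ → E := fun θ => ∑' n : ℤ, Complex.exp (n * θ * Complex.I) • b n with hu
  have hsum : ∀ θ : ℝ, HasSum (fun n : ℤ => Complex.exp (n * θ * Complex.I) • b n) (u θ) := fun θ =>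
    (Summable.of_norm_bounded hb fun n => (hnorm n θ).le).hasSum
  have huc : Continuous u := continuous_tsum (fun n => by fun_prop) hb fun n θ => (hnorm n θ).le
  have hub : ∀ θ : ℝ, ‖u θ‖ ≤ ∑' n, ‖b n‖ := fun θ =>
    tsum_of_norm_bounded hb.hasSum fun n => (hnorm n θ).le
  -- The Fourier coefficients of `u`, by termwise integration.
  have hcoef : ∀ m : ℤ, ∫ θ, Complex.exp (((-m : ℤ) : ℂ) * θ * Complex.I) • u θ ∂μ =
      ((2 * Real.pi : ℝ) : ℂ) • b m := by
    intro m
    have h1 : ∀ θ : ℝ, Complex.exp (((-m : ℤ) : ℂ) * θ * Complex.I) • u θ =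
        ∑' n : ℤ, Complex.exp (((n - m : ℤ) : ℂ) * θ * Complex.I) • b n := by
      intro θ
      rw [← ((hsum θ).const_smul (Complex.exp (((-m : ℤ) : ℂ) * θ * Complex.I))).tsum_eq]
      refine tsum_congr fun n => ?_
      rw [smul_smul, ← Complex.exp_add]
      congr 2
      push_cast
      ring
    simp_rw [h1]
    have h2 := hasSum_integral_of_summable_integral_norm (μ := μ)
      (F := fun (n : ℤ) (θ : ℝ) => Complex.exp (((n - m : ℤ) : ℂ) * θ * Complex.I) • b n)
      (fun n => (Continuous.integrableOn_Ioc (by fun_prop))) (by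
        simp_rw [norm_smul, norm_exp_int_mul, one_mul, integral_const, hμr]
        exact hb.mul_left _)
    rw [← h2.tsum_eq, tsum_eq_single m]
    · rw [integral_smul_const, integral_exp_int_mul]
      simp
    · intro n hn
      rw [integral_smul_const, integral_exp_int_mul, if_neg (sub_ne_zero.2 hn), zero_smul]
  -- Expanding only one of the two factors of `⟪u, u⟫` keeps a single sum.
  have hsq : ∀ θ : ℝ, HasSum (fun m : ℤ => RCLike.re (inner ℂ (b m)
      (Complex.exp (((-m : ℤ) : ℂ) * θ * Complex.I) • u θ))) (‖u θ‖ ^ 2) := by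
    intro θ
    have h1 := RCLike.hasSum_re ℂ ((innerSL ℂ (u θ)).hasSum (hsum θ))
    rw [innerSL_apply_apply, inner_self_eq_norm_sq (𝕜 := ℂ)] at h1
    refine h1.congr_fun fun m => ?_
    rw [innerSL_apply_apply, ← inner_re_symm, inner_smul_left, inner_smul_right,
      ← Complex.exp_conj]
    congr 3
    simp
  have hint : ∀ m : ℤ, Continuous fun θ : ℝ => inner ℂ (b m)
      (Complex.exp (((-m : ℤ) : ℂ) * θ * Complex.I) • u θ) := fun m => by fun_prop
  have hH : HasSum (fun m : ℤ => 2 * Real.pi * ‖b m‖ ^ 2) (∫ θ, ‖u θ‖ ^ 2 ∂μ) := by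
    have h2 := hasSum_integral_of_summable_integral_norm (μ := μ)
      (F := fun (m : ℤ) (θ : ℝ) => RCLike.re (inner ℂ (b m)
        (Complex.exp (((-m : ℤ) : ℂ) * θ * Complex.I) • u θ)))
      (fun m => (RCLike.continuous_re.comp (hint m)).integrableOn_Ioc) (by
        refine Summable.of_nonneg_of_le (fun m => integral_nonneg fun θ => norm_nonneg _) (fun m => ?_)
          (hb.mul_left ((∑' n, ‖b n‖) * (2 * Real.pi)))
        calc _ ≤ ∫ θ, ‖b m‖ * ∑' n, ‖b n‖ ∂μ := by
              refine integral_mono ?_ (integrable_const _) fun θ => ?_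
              · exact ((RCLike.continuous_re.comp (hint m)).norm).integrableOn_Ioc
              · refine (RCLike.norm_re_le_norm _).trans ((norm_inner_le_norm _ _).trans ?_)
                rw [norm_smul, norm_exp_int_mul, one_mul]
                gcongr
                exact hub θ
          _ = _ := by rw [integral_const, hμr, smul_eq_mul]; ring)
    simp_rw [fun θ => (hsq θ).tsum_eq] at h2
    convert! h2 using 2 with m
    have h3 : Integrable (fun θ : ℝ => inner ℂ (b m)
      (Complex.exp (((-m : ℤ) : ℂ) * θ * Complex.I) • u θ)) μ := (hint m).integrableOn_Ioc
    rw [integral_re h3, integral_inner (Continuous.integrableOn_Ioc (by fun_prop)), hcoef,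
      inner_smul_right, inner_self_eq_norm_sq_to_K]
    simp [← Complex.ofReal_pow]
  have hi : Integrable (fun θ => ‖u θ‖ ^ 2) μ := (huc.norm.pow 2).integrableOn_Ioc
  calc ∫⁻ θ, ‖u θ‖ₑ ^ 2 ∂μ = ∫⁻ θ, ENNReal.ofReal (‖u θ‖ ^ 2) ∂μ := by
        refine lintegral_congr fun θ => ?_
        rw [ENNReal.ofReal_pow (norm_nonneg _), ofReal_norm]
    _ = ENNReal.ofReal (∑' m : ℤ, 2 * Real.pi * ‖b m‖ ^ 2) := by
        rw [hH.tsum_eq, ofReal_integral_eq_lintegral_ofReal hi (by filter_upwards with θ; positivity)]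
    _ = _ := by
        rw [ENNReal.ofReal_tsum_of_nonneg (fun m => by positivity) hH.summable, ← ENNReal.tsum_mul_left]
        refine tsum_congr fun m => ?_
        rw [ENNReal.ofReal_mul (by positivity), ENNReal.ofReal_pow (norm_nonneg _), ofReal_norm]

end Parseval

/-! ### Fourier modes of `z ↦ (∑ z ^ k A_k) (∑ z̄ ^ m c_m)` -/

section Product

variable {E : Type*} [NormedAddCommGroup E] [InnerProductSpace ℂ E] [CompleteSpace E]

theorem circleMap_zero_zpow {r : ℝ} (n : ℤ) (θ : ℝ) :
    circleMap 0 r θ ^ n = ((r ^ n : ℝ) : ℂ) * Complex.exp (n * θ * Complex.I) := by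
  rw [circleMap_zero, mul_zpow, ← Complex.exp_int_mul, Complex.ofReal_zpow]
  congr 2
  ring

theorem conj_circleMap_zero_pow {r : ℝ} (n : ℕ) (θ : ℝ) :
    conj (circleMap 0 r θ) ^ n =
      ((r ^ n : ℝ) : ℂ) * Complex.exp (((-n : ℤ) : ℂ) * θ * Complex.I) := by
  rw [circleMap_zero, map_mul, mul_pow, ← Complex.exp_conj, ← Complex.exp_nat_mul]
  simp only [Complex.conj_ofReal, Complex.ofReal_pow, map_mul, Complex.conj_I]
  congr 2
  push_cast
  ring

/-- The map `z ↦ (∑ z ^ k A_k) (∑ z̄ ^ m c_m)` on the circle of radius `r` has the Fourier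
coefficients `∑_m r ^ (n + 2 m) A_{n + m} c_m`; Parseval's identity for it. -/
theorem lintegral_enorm_mul_conj_sq (a : ℝ) {r : ℝ} (hr : 0 < r) {A : ℤ → E →L[ℂ] E} {c : ℕ → E}
    (hA : Summable fun k => ‖A k‖ * r ^ k) (hc : Summable fun m => ‖c m‖ * r ^ m) :
    ∫⁻ θ in Ioc a (a + 2 * Real.pi), ‖(∑' k : ℤ, circleMap 0 r θ ^ k • A k)
        (∑' m : ℕ, conj (circleMap 0 r θ) ^ m • c m)‖ₑ ^ 2 =
      ENNReal.ofReal (2 * Real.pi) *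
        ∑' n : ℤ, ‖∑' m : ℕ, r ^ (n + 2 * m) • A (n + m) (c m)‖ₑ ^ 2 := by
  -- The reindexing `(n, m) ↦ (k, m) = (n + m, m)` collects the terms of frequency `n = k - m`.
  let e : ℤ × ℕ ≃ ℤ × ℕ :=
    { toFun := fun p => (p.1 + p.2, p.2)
      invFun := fun p => (p.1 - p.2, p.2)
      left_inv := fun p => by simp
      right_inv := fun p => by simp }
  have hprod : Summable fun p : ℤ × ℕ => (‖A p.1‖ * r ^ p.1) * (‖c p.2‖ * r ^ p.2) :=
    hA.mul_of_nonneg hc (fun _ => by positivity) (fun _ => by positivity)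
  have hprod' : Summable fun p : ℤ × ℕ => ‖r ^ (p.1 + 2 * p.2) • A (p.1 + p.2) (c p.2)‖ := by
    refine Summable.of_nonneg_of_le (fun _ => norm_nonneg _) (fun p => ?_)
      ((e.summable_iff).2 hprod)
    simp only [Function.comp, e, Equiv.coe_fn_mk]
    rw [norm_smul, Real.norm_of_nonneg (by positivity), two_mul, ← add_assoc, zpow_add₀ hr.ne',
      zpow_natCast]
    calc _ ≤ r ^ (p.1 + (p.2 : ℤ)) * r ^ p.2 * (‖A (p.1 + p.2)‖ * ‖c p.2‖) := by
          gcongr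
          exact ContinuousLinearMap.le_opNorm _ _
      _ = _ := by ring
  have hb : Summable fun n : ℤ => ‖∑' m : ℕ, r ^ (n + 2 * m) • A (n + m) (c m)‖ := by
    refine Summable.of_nonneg_of_le (fun _ => norm_nonneg _) (fun n => ?_) hprod'.prod
    exact norm_tsum_le_tsum_norm (hprod'.prod_factor n)
  rw [← lintegral_enorm_fourier_sq a hb]
  refine lintegral_congr fun θ => ?_
  congr 2
  set z := circleMap 0 r θ with hz
  have hzr : ‖z‖ = r := by rw [hz, norm_circleMap_zero, abs_of_pos hr]
  set G : ℤ × ℕ → E := fun p => (z ^ p.1 • A p.1) (conj z ^ p.2 • c p.2) with hG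
  have hGs : Summable G := by
    refine Summable.of_norm_bounded hprod fun p => ?_
    refine (ContinuousLinearMap.le_opNorm _ _).trans (le_of_eq ?_)
    rw [norm_smul, norm_smul, norm_zpow, norm_pow, RCLike.norm_conj, hzr]
    ring
  have hcs : Summable fun m : ℕ => conj z ^ m • c m := by
    refine Summable.of_norm_bounded hc fun m => le_of_eq ?_
    rw [norm_smul, norm_pow, RCLike.norm_conj, hzr, mul_comm]
  have hAs : Summable fun k : ℤ => z ^ k • A k := by
    refine Summable.of_norm_bounded hA fun m => le_of_eq ?_
    rw [norm_smul, norm_zpow, hzr, mul_comm]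
  calc _ = ∑' p, G p := by
        rw [hGs.tsum_prod]
        simp only [hG]
        simp_rw [← ContinuousLinearMap.map_tsum _ hcs]
        exact (ContinuousLinearMap.apply ℂ E (∑' m : ℕ, conj z ^ m • c m)).map_tsum hAs
    _ = ∑' p, G (e p) := (e.tsum_eq G).symm
    _ = ∑' (n : ℤ) (m : ℕ), G (e (n, m)) := ((e.summable_iff).2 hGs).tsum_prod
    _ = _ := by
        refine tsum_congr fun n => ?_
        rw [← (hprod'.of_norm.prod_factor n).tsum_const_smul]
        refine tsum_congr fun m => ?_
        have hpow : r ^ (n + 2 * m : ℤ) = r ^ (n + m : ℤ) * r ^ m := by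
          rw [two_mul, ← add_assoc, zpow_add₀ hr.ne' (n + m), zpow_natCast]
        have hE : Complex.exp (((n + m : ℤ) : ℂ) * θ * Complex.I) *
            Complex.exp (((-m : ℤ) : ℂ) * θ * Complex.I) = Complex.exp (n * θ * Complex.I) := by
          rw [← Complex.exp_add]
          congr 1
          push_cast
          ring
        simp only [hG, e, Equiv.coe_fn_mk, smul_apply, map_smul]
        rw [hz, circleMap_zero_zpow, conj_circleMap_zero_pow, smul_smul, ← Complex.coe_smul,
          smul_smul, hpow, ← hE]
        congr 1
        push_cast
        ring

/-- The same identity in the logarithmic variable, on the circle of radius `e ^ (-s / 2)`. -/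
theorem lintegral_enorm_mul_conj_sq_exp (a : ℝ) {s : ℝ} (hs : 0 < s) {u : ℕ → E →L[ℂ] E} {c : ℕ → E}
    (hu : SubExp u) (hc : ExpDecay c) :
    ∫⁻ θ in Ioc a (a + 2 * Real.pi), ‖(∑' k : ℕ, circleMap 0 (Real.exp (-s / 2)) θ ^ k • u k)
        (∑' m : ℕ, conj (circleMap 0 (Real.exp (-s / 2)) θ) ^ m • c m)‖ₑ ^ 2 =
      ENNReal.ofReal (2 * Real.pi) * ∑' n : ℤ, ENNReal.ofReal (Real.exp (-n * s)) *
        ‖expSeries (fun m => zeroExtend u (n + m) (c m)) s‖ₑ ^ 2 := by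
  have h1 : Real.exp (-s / 2) < 1 := Real.exp_lt_one_iff.2 (by linarith)
  simp_rw [← tsum_zpow_smul_zeroExtend u]
  rw [lintegral_enorm_mul_conj_sq a (Real.exp_pos _)
    (hu.summable_zeroExtend (Real.exp_pos _) h1)
    (hc.summable_mul_pow (Real.exp_nonneg _) h1.le)]
  congr 1
  refine tsum_congr fun n => ?_
  have h2 : ∀ m : ℕ, Real.exp (-s / 2) ^ (n + 2 * m : ℤ) =
      Real.exp (-n * s / 2) * Real.exp (-(m * s)) := fun m => by
    rw [← Real.rpow_intCast, ← Real.exp_mul, ← Real.exp_add]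
    congr 1
    push_cast
    ring
  simp_rw [h2, mul_smul]
  rw [tsum_const_smul'', enorm_smul, mul_pow, expSeries, Real.enorm_of_nonneg (Real.exp_nonneg _),
    ← ENNReal.ofReal_pow (Real.exp_nonneg _), ← Real.exp_nat_mul]
  congr 3
  push_cast
  ring

end Product

/-! ### The pointwise bound for `D ^ (1 + α) φ` -/

section Bloch

variable {E : Type*} [NormedAddCommGroup E] [NormedSpace ℂ E] [CompleteSpace E]

/-- The Taylor coefficients of `Γ_φ f` in terms of those of `φ` and `f`. -/
noncomputable def hankelCoeff (a : ℕ → E →L[ℂ] E) (c : ℕ → E) (n : ℕ) : E :=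
  ∑' m : ℕ, a (m + n) (c m)

theorem rpow_succ_sub_rpow_le {α : ℝ} (hα : 0 < α) (n : ℕ) :
    (1 + (n : ℝ)) ^ (1 + α) - (n : ℝ) ^ (1 + α) ≤ (1 + α) * (1 + (n : ℝ)) ^ α := by
  have hN : (0 : ℝ) < 1 + n := by positivity
  have h1 := one_add_mul_self_le_rpow_one_add (s := -(1 + (n : ℝ))⁻¹)
    (by rw [neg_le_neg_iff]; exact inv_le_one_of_one_le₀ (by linarith [Nat.cast_nonneg (α := ℝ) n]))
    (show 1 ≤ 1 + α by linarith)
  have h2 : (n : ℝ) = (1 + n) * (1 + -(1 + (n : ℝ))⁻¹) := by field_simp; ring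
  have h3 : 0 ≤ 1 + -(1 + (n : ℝ))⁻¹ := by
    have : (1 + (n : ℝ))⁻¹ ≤ 1 := inv_le_one_of_one_le₀ (by linarith [Nat.cast_nonneg (α := ℝ) n])
    linarith
  have h4 : (n : ℝ) ^ (1 + α) = (1 + (n : ℝ)) ^ (1 + α) * (1 + -(1 + (n : ℝ))⁻¹) ^ (1 + α) := by
    rw [← Real.mul_rpow hN.le h3, ← h2]
  have h5 : (1 + (n : ℝ)) ^ (1 + α) = (1 + (n : ℝ)) ^ α * (1 + n) := by
    rw [add_comm 1 α, Real.rpow_add_one hN.ne']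
  rw [h4]
  have h6 := mul_le_mul_of_nonneg_left h1 (Real.rpow_nonneg hN.le (1 + α))
  have h7 : (1 + (n : ℝ)) ^ (1 + α) * ((1 + α) * -(1 + (n : ℝ))⁻¹) = -((1 + α) * (1 + (n : ℝ)) ^ α) := by
    rw [h5]; field_simp
  nlinarith

theorem sum_rpow_succ_sub_rpow {α : ℝ} (hα : 0 < α) (k : ℕ) :
    ∑ n ∈ Finset.range (k + 1), ((1 + (n : ℝ)) ^ (1 + α) - (n : ℝ) ^ (1 + α)) =
      (1 + (k : ℝ)) ^ (1 + α) := by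
  have h := Finset.sum_range_sub (fun n : ℕ => (n : ℝ) ^ (1 + α)) (k + 1)
  simp only [Nat.cast_add, Nat.cast_one, Nat.cast_zero] at h
  rw [Real.zero_rpow (by positivity), sub_zero] at h
  simpa only [add_comm (1 : ℝ)] using h

/-- Testing against a geometric series: with `d_n = (1 + n) ^ (1 + α) - n ^ (1 + α)`, so that
`d_0 + ⋯ + d_k = (1 + k) ^ (1 + α)`, the value of `D ^ (1 + α) φ (z) x` is
`∑ d_n z ^ n (Γ_φ f)^(n)` for `f(w) = x / (1 - z w)`. -/
theorem tsum_smul_apply_eq_tsum_hankelCoeff {α : ℝ} (hα : 0 < α) {a : ℕ → E →L[ℂ] E} (ha : SubExp a)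
    {z : ℂ} (hz : ‖z‖ < 1) (x : E) :
    (∑' k : ℕ, (z ^ k * (((1 + (k : ℝ)) ^ (1 + α) : ℝ) : ℂ)) • a k) x =
      ∑' n : ℕ, ((((1 + (n : ℝ)) ^ (1 + α) - (n : ℝ) ^ (1 + α) : ℝ) : ℂ) * z ^ n) •
        hankelCoeff a (fun m => z ^ m • x) n := by
  set d : ℕ → ℝ := fun n => (1 + (n : ℝ)) ^ (1 + α) - (n : ℝ) ^ (1 + α) with hd
  have hd0 : ∀ n, 0 ≤ d n := fun n => by
    rw [hd, sub_nonneg]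
    exact Real.rpow_le_rpow (by positivity) (by linarith) (by positivity)
  obtain ⟨q, hq0, hq1, hq⟩ := exists_le_sq hz
  obtain ⟨K, hK, hb⟩ := ha.exists_bound hq0 hq1
  set G : ℕ × ℕ → E := fun p => ((d p.1 : ℂ) * z ^ (p.1 + p.2)) • a (p.2 + p.1) x with hG
  have hds : Summable fun n => d n * q ^ n :=
    Summable.of_nonneg_of_le (fun n => mul_nonneg (hd0 n) (by positivity))
      (fun n => by
        rw [← mul_assoc]
        exact mul_le_mul_of_nonneg_right (rpow_succ_sub_rpow_le hα n) (by positivity))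
      ((summable_rpow_mul_geometric α hq0 hq1).mul_left (1 + α))
  have hGs : Summable G := by
    refine Summable.of_norm_bounded ((hds.mul_of_nonneg (summable_geometric_of_lt_one hq0.le hq1)
      (fun n => mul_nonneg (hd0 n) (by positivity)) (fun n => by positivity)).mul_left (K * ‖x‖))
      fun p => ?_
    rw [hG]
    simp only
    rw [norm_smul, norm_mul, norm_pow, Complex.norm_real, Real.norm_of_nonneg (hd0 _)]
    calc d p.1 * ‖z‖ ^ (p.1 + p.2) * ‖a (p.2 + p.1) x‖
        ≤ d p.1 * (q * q) ^ (p.1 + p.2) * (‖a (p.2 + p.1)‖ * ‖x‖) := by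
          have := hd0 p.1
          gcongr
          exact ContinuousLinearMap.le_opNorm _ _
      _ = (‖a (p.2 + p.1)‖ * q ^ (p.2 + p.1)) * ‖x‖ * (d p.1 * q ^ p.1 * q ^ p.2) := by
          rw [mul_pow, add_comm p.2]; ring
      _ ≤ K * ‖x‖ * (d p.1 * q ^ p.1 * q ^ p.2) := by
          have := hd0 p.1
          gcongr
          exact hb _
  have hΦ : Summable fun k : ℕ => (z ^ k * (((1 + (k : ℝ)) ^ (1 + α) : ℝ) : ℂ)) • a k := by
    have h1 : SubExp fun k : ℕ => (((1 + (k : ℝ)) ^ (1 + α) : ℝ) : ℂ) • a k :=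
      ha.of_norm_le (1 + α) fun n => by
        rw [norm_smul, Complex.norm_real, Real.norm_of_nonneg (by positivity)]
    refine Summable.of_norm_bounded (h1 (q * q) (by positivity) (by nlinarith)) fun k => ?_
    rw [mul_smul, norm_smul, norm_pow, mul_comm]
    gcongr
  rw [show (∑' k : ℕ, (z ^ k * (((1 + (k : ℝ)) ^ (1 + α) : ℝ) : ℂ)) • a k) x =
    ∑' k : ℕ, ((z ^ k * (((1 + (k : ℝ)) ^ (1 + α) : ℝ) : ℂ)) • a k) x from
    (ContinuousLinearMap.apply ℂ E x).map_tsum hΦ]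
  have hR : ∀ n, (((d n : ℝ) : ℂ) * z ^ n) • hankelCoeff a (fun m => z ^ m • x) n =
      ∑' m, G (n, m) := fun n => by
    have h1 : ∀ m, G (n, m) = (((d n : ℝ) : ℂ) * z ^ n) • a (m + n) (z ^ m • x) := fun m => by
      simp only [hG, map_smul, smul_smul, pow_add]
      congr 1
      ring
    simp_rw [h1]
    rw [tsum_const_smul'', hankelCoeff]
  rw [tsum_congr hR]
  -- Summation along `n + m = k`, where the `d_n` telescope.
  have hsig := ((Finset.HasAntidiagonal.sigmaAntidiagonalEquivProd (A := ℕ)).summable_iff).2 hGs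
  rw [← hGs.tsum_prod, ← (Finset.HasAntidiagonal.sigmaAntidiagonalEquivProd (A := ℕ)).tsum_eq G]
  refine Eq.trans ?_ (hsig.tsum_sigma' fun k => (hasSum_fintype _).summable).symm
  refine tsum_congr fun k => ?_
  rw [tsum_fintype, Finset.sum_coe_sort_eq_attach]
  refine Eq.trans ?_ (Finset.sum_attach (Finset.HasAntidiagonal.antidiagonal k) G).symm
  have h2 : ∀ p ∈ Finset.HasAntidiagonal.antidiagonal k, G p = ((d p.1 : ℝ) : ℂ) • (z ^ k • a k x) := fun p hp => by
    rw [Finset.HasAntidiagonal.mem_antidiagonal] at hp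
    simp only [hG]
    rw [hp, add_comm p.2, hp, mul_smul]
  rw [Finset.sum_congr rfl h2, ← Finset.sum_smul,
    Finset.Nat.sum_antidiagonal_eq_sum_range_succ (fun i _ => ((d i : ℝ) : ℂ)),
    ← Complex.ofReal_sum, hd, sum_rpow_succ_sub_rpow hα, smul_smul, mul_comm]
  rfl

/-- Boundedness of `D ^ α Γ_φ` implies the pointwise bound
`‖D ^ (1 + α) φ (z)‖ ≤ (1 + α) ‖D ^ α Γ_φ‖ / (1 - |z| ^ 2)`. -/
theorem enorm_tsum_smul_apply_sq_le {α : ℝ} (hα : 0 < α) {a : ℕ → E →L[ℂ] E} (ha : SubExp a)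
    {B : ℝ≥0∞} (hB : ∀ c : ℕ → E, ExpDecay c →
      ∑' n : ℕ, (ENNReal.ofReal ((1 + (n : ℝ)) ^ α) * ‖hankelCoeff a c n‖ₑ) ^ 2 ≤
        B * ∑' m, ‖c m‖ₑ ^ 2) {z : ℂ} (hz : ‖z‖ < 1) (x : E) :
    ‖(∑' k : ℕ, (z ^ k * (((1 + (k : ℝ)) ^ (1 + α) : ℝ) : ℂ)) • a k) x‖ₑ ^ 2 ≤
      ENNReal.ofReal (((1 + α) * (1 - ‖z‖ ^ 2)⁻¹) ^ 2) * B * ‖x‖ₑ ^ 2 := by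
  rw [tsum_smul_apply_eq_tsum_hankelCoeff hα ha hz]
  have hz2 : ‖z‖ ^ 2 < 1 := pow_lt_one₀ (norm_nonneg _) hz two_ne_zero
  have hgeo : ∑' n : ℕ, ENNReal.ofReal (‖z‖ ^ n) ^ 2 = ENNReal.ofReal ((1 - ‖z‖ ^ 2)⁻¹) := by
    rw [← tsum_geometric_of_lt_one (by positivity) hz2, ENNReal.ofReal_tsum_of_nonneg
      (fun n => by positivity) (summable_geometric_of_lt_one (by positivity) hz2)]
    refine tsum_congr fun n => ?_
    rw [← ENNReal.ofReal_pow (by positivity), ← pow_mul, ← pow_mul, mul_comm]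
  have hpos : 0 < (1 - ‖z‖ ^ 2)⁻¹ := inv_pos.2 (by linarith)
  calc _ ≤ (∑' n : ℕ, ‖((((1 + (n : ℝ)) ^ (1 + α) - (n : ℝ) ^ (1 + α) : ℝ) : ℂ) * z ^ n) •
        hankelCoeff a (fun m => z ^ m • x) n‖ₑ) ^ 2 := by
        gcongr
        exact enorm_tsum_le_tsum_enorm
    _ ≤ (∑' n : ℕ, ENNReal.ofReal ((1 + α) * ‖z‖ ^ n) * (ENNReal.ofReal ((1 + (n : ℝ)) ^ α) *
        ‖hankelCoeff a (fun m => z ^ m • x) n‖ₑ)) ^ 2 := by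
        gcongr with n
        rw [enorm_smul, ← mul_assoc, ← ENNReal.ofReal_mul (by positivity), ← ofReal_norm, norm_mul,
          norm_pow, Complex.norm_real, Real.norm_of_nonneg (sub_nonneg.2
            (Real.rpow_le_rpow (by positivity) (by linarith) (by positivity)))]
        refine mul_le_mul_left (ENNReal.ofReal_le_ofReal ?_) _
        rw [mul_right_comm]
        exact mul_le_mul_of_nonneg_right (rpow_succ_sub_rpow_le hα n) (by positivity)
    _ ≤ (∑' n : ℕ, ENNReal.ofReal ((1 + α) * ‖z‖ ^ n) ^ 2) * ∑' n : ℕ,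
        (ENNReal.ofReal ((1 + (n : ℝ)) ^ α) * ‖hankelCoeff a (fun m => z ^ m • x) n‖ₑ) ^ 2 :=
        tsum_mul_sq_le _ _
    _ ≤ (ENNReal.ofReal (1 + α) ^ 2 * ENNReal.ofReal ((1 - ‖z‖ ^ 2)⁻¹)) *
        (B * ∑' m : ℕ, ‖z ^ m • x‖ₑ ^ 2) := by
        refine mul_le_mul' (le_of_eq ?_) (hB _ (expDecay_geometric hz x))
        rw [← hgeo, ← ENNReal.tsum_mul_left]
        refine tsum_congr fun n => ?_
        rw [ENNReal.ofReal_mul (by positivity), mul_pow]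
    _ = _ := by
        have h1 : ∑' m : ℕ, ‖z ^ m • x‖ₑ ^ 2 = ENNReal.ofReal ((1 - ‖z‖ ^ 2)⁻¹) * ‖x‖ₑ ^ 2 := by
          rw [← hgeo, ← ENNReal.tsum_mul_right]
          refine tsum_congr fun n => ?_
          rw [enorm_smul, mul_pow, ← ofReal_norm (z ^ n), norm_pow]
        rw [h1, ENNReal.ofReal_pow (by positivity), ENNReal.ofReal_mul (by positivity)]
        ring

end Bloch

/-! ### Parseval's identity for power series -/

section ParsevalPowerSeries

theorem enorm_ofReal_smul_sq {E : Type*} [NormedAddCommGroup E] [NormedSpace ℂ E] {r : ℝ}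
    (hr : 0 ≤ r) (m : ℕ) (x : E) :
    ‖((r ^ m : ℝ) : ℂ) • x‖ₑ ^ 2 = ENNReal.ofReal (r ^ (2 * m)) * ‖x‖ₑ ^ 2 := by
  rw [enorm_smul, mul_pow, ← ofReal_norm, Complex.norm_real, Real.norm_of_nonneg (by positivity),
    ← ENNReal.ofReal_pow (by positivity), ← pow_mul, mul_comm m]

variable {E : Type*} [NormedAddCommGroup E] [InnerProductSpace ℂ E] [CompleteSpace E]

theorem lintegral_enorm_fourier_sq_of_injective (a : ℝ) {ι : ℕ → ℤ} (hι : Function.Injective ι)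
    {v : ℕ → E} (hv : Summable fun m => ‖v m‖) :
    ∫⁻ θ in Ioc a (a + 2 * Real.pi), ‖∑' m : ℕ, Complex.exp (ι m * θ * Complex.I) • v m‖ₑ ^ 2 =
      ENNReal.ofReal (2 * Real.pi) * ∑' m : ℕ, ‖v m‖ₑ ^ 2 := by
  set b : ℤ → E := Function.extend ι v 0 with hb
  have hb1 : ∀ m, b (ι m) = v m := fun m => hι.extend_apply _ _ _
  have hb0 : ∀ n, n ∉ range ι → b n = 0 := fun n hn =>
    Function.extend_apply' _ _ _ (by simpa using hn)
  have hbs : Summable fun n => ‖b n‖ := by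
    rw [← hι.summable_iff (fun n hn => by rw [hb0 n hn, norm_zero])]
    simpa only [Function.comp_def, hb1] using hv
  have h1 : ∀ θ : ℝ, ∑' m : ℕ, Complex.exp (ι m * θ * Complex.I) • v m =
      ∑' n : ℤ, Complex.exp (n * θ * Complex.I) • b n := fun θ => by
    rw [← hι.tsum_eq (f := fun n : ℤ => Complex.exp (n * θ * Complex.I) • b n)]
    · simp only [hb1]
    · intro n hn
      by_contra h
      exact hn (by simp only [hb0 n h, smul_zero])
  have h2 : ∑' m : ℕ, ‖v m‖ₑ ^ 2 = ∑' n : ℤ, ‖b n‖ₑ ^ 2 := by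
    rw [← hι.tsum_eq (f := fun n : ℤ => ‖b n‖ₑ ^ 2)]
    · simp only [hb1]
    · intro n hn
      by_contra h
      exact hn (by simp [hb0 n h])
  simp_rw [h1]
  rw [h2, lintegral_enorm_fourier_sq a hbs]

/-- Parseval's identity for a power series on the circle of radius `r`. -/
theorem lintegral_enorm_tsum_pow_sq (a : ℝ) {r : ℝ} (hr : 0 ≤ r) {v : ℕ → E}
    (hv : Summable fun m => ‖v m‖ * r ^ m) :
    ∫⁻ θ in Ioc a (a + 2 * Real.pi), ‖∑' m : ℕ, circleMap 0 r θ ^ m • v m‖ₑ ^ 2 =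
      ENNReal.ofReal (2 * Real.pi) * ∑' m : ℕ, ENNReal.ofReal (r ^ (2 * m)) * ‖v m‖ₑ ^ 2 := by
  simp_rw [← enorm_ofReal_smul_sq hr]
  rw [← lintegral_enorm_fourier_sq_of_injective a (ι := fun m => (m : ℤ)) Nat.cast_injective]
  · refine lintegral_congr fun θ => ?_
    congr 2
    refine tsum_congr fun m => ?_
    rw [← zpow_natCast, circleMap_zero_zpow, smul_smul, mul_comm, zpow_natCast]
  · refine hv.congr fun m => ?_
    rw [norm_smul, Complex.norm_real, Real.norm_of_nonneg (by positivity), mul_comm]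

/-- Parseval's identity for an anti-analytic power series on the circle of radius `r`. -/
theorem lintegral_enorm_tsum_conj_pow_sq (a : ℝ) {r : ℝ} (hr : 0 ≤ r) {v : ℕ → E}
    (hv : Summable fun m => ‖v m‖ * r ^ m) :
    ∫⁻ θ in Ioc a (a + 2 * Real.pi), ‖∑' m : ℕ, conj (circleMap 0 r θ) ^ m • v m‖ₑ ^ 2 =
      ENNReal.ofReal (2 * Real.pi) * ∑' m : ℕ, ENNReal.ofReal (r ^ (2 * m)) * ‖v m‖ₑ ^ 2 := by
  simp_rw [← enorm_ofReal_smul_sq hr]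
  rw [← lintegral_enorm_fourier_sq_of_injective a (ι := fun m => -(m : ℤ))
    (neg_injective.comp Nat.cast_injective)]
  · refine lintegral_congr fun θ => ?_
    congr 2
    refine tsum_congr fun m => ?_
    rw [conj_circleMap_zero_pow, smul_smul, mul_comm]
  · refine hv.congr fun m => ?_
    rw [norm_smul, Complex.norm_real, Real.norm_of_nonneg (by positivity), mul_comm]

end ParsevalPowerSeries

/-! ### Estimates for a single Fourier mode -/

section Energy

variable {E : Type*} [NormedAddCommGroup E] [NormedSpace ℂ E]

/-- The coefficients `a_{n + m} c_m` decay exponentially in `m` for every integer `n`: the decay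
rate of `c` beats the subexponential growth of `a`. -/
theorem ExpDecay.zeroExtend_apply {u : ℕ → E →L[ℂ] E} {c : ℕ → E} (hc : ExpDecay c)
    (hu : SubExp u) (n : ℤ) : ExpDecay fun m : ℕ => zeroExtend u (n + m) (c m) := by
  obtain ⟨R, hR, hs⟩ := hc
  have hR0 : 0 < R := one_pos.trans hR
  obtain ⟨q, hq0, hq1, hq⟩ := exists_le_sq (inv_lt_one_of_one_lt₀ hR)
  have hsz := hu.summable_zeroExtend hq0 hq1
  set K := ∑' k : ℤ, ‖zeroExtend u k‖ * q ^ k with hK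
  have hb : ∀ k : ℤ, ‖zeroExtend u k‖ ≤ K * q ^ (-k) := fun k => by
    have h1 : ‖zeroExtend u k‖ * q ^ k ≤ K := hsz.le_tsum k fun m _ => by positivity
    rw [zpow_neg, ← div_eq_mul_inv, le_div_iff₀ (by positivity)]
    exact h1
  refine ⟨R * q, ?_, ?_⟩
  · rw [inv_le_iff_one_le_mul₀ hR0] at hq
    nlinarith
  · refine Summable.of_nonneg_of_le (fun m => by positivity) (fun m => ?_)
      (hs.mul_left (K * q ^ (-n)))
    calc ‖zeroExtend u (n + m) (c m)‖ * (R * q) ^ m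
        ≤ (K * q ^ (-(n + m : ℤ)) * ‖c m‖) * (R * q) ^ m := by
          gcongr
          exact ((zeroExtend u (n + m)).le_opNorm (c m)).trans (by gcongr; exact hb _)
      _ = K * q ^ (-n) * (‖c m‖ * R ^ m) * (q ^ (-(m : ℤ)) * q ^ m) := by
          rw [neg_add, zpow_add₀ hq0.ne', mul_pow]; ring
      _ = _ := by
          rw [← zpow_natCast q m, ← zpow_add₀ hq0.ne']
          simp

/-- The coefficients of `D ^ β φ` in terms of those of `φ`. -/
noncomputable def rpowMul (β : ℝ) (a : ℕ → E →L[ℂ] E) (k : ℕ) : E →L[ℂ] E :=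
  (((1 + (k : ℝ)) ^ β : ℝ) : ℂ) • a k

theorem SubExp.rpowMul {a : ℕ → E →L[ℂ] E} (ha : SubExp a) (β : ℝ) : SubExp (rpowMul β a) :=
  ha.of_norm_le β fun n => by
    rw [VectorHankel.rpowMul, norm_smul, Complex.norm_real, Real.norm_of_nonneg (by positivity)]

theorem ExpDecay.natCast_smul {c : ℕ → E} (hc : ExpDecay c) : ExpDecay fun m : ℕ => (m : ℝ) • c m :=
  hc.of_norm_le 1 fun n => by
    rw [norm_smul, Real.rpow_one, Real.norm_of_nonneg (by positivity)]
    gcongr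
    linarith

variable [CompleteSpace E]

/-- Termwise integration with Euler's integral `∫ s ^ α e ^ (-(N + m) s) ds`. -/
theorem integral_rpow_mul_exp_smul_expSeries {α N : ℝ} (hα : 0 < α) (hN : 0 < N) {b : ℕ → E}
    (hb : Summable fun m => ‖b m‖) :
    ∫ s in Ioi (0 : ℝ), (s ^ α * Real.exp (-N * s)) • expSeries b s =
      Real.Gamma (1 + α) • ∑' m : ℕ, (N + m) ^ (-(1 + α)) • b m := by
  have hα1 : 0 < 1 + α := by linarith
  have hG := Real.Gamma_pos_of_pos hα1
  have hI : ∀ m : ℕ, IntegrableOn (fun s : ℝ => s ^ α * Real.exp (-N * s) * Real.exp (-(m * s)))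
      (Ioi 0) ∧ ∫ s in Ioi (0 : ℝ), s ^ α * Real.exp (-N * s) * Real.exp (-(m * s)) =
        Real.Gamma (1 + α) * (N + m) ^ (-(1 + α)) := by
    intro m
    have hNm : 0 < N + m := by positivity
    have h1 : ∀ s : ℝ, s ^ α * Real.exp (-N * s) * Real.exp (-(m * s)) =
        s ^ (1 + α - 1) * Real.exp (-((N + m) * s)) := fun s => by
      rw [mul_assoc, ← Real.exp_add, add_sub_cancel_left]
      congr 2
      ring
    simp_rw [h1]
    refine ⟨integrableOn_rpow_mul_exp_neg_mul hα1 hNm, ?_⟩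
    rw [Real.integral_rpow_mul_exp_neg_mul_Ioi hα1 hNm, mul_comm, one_div,
      Real.inv_rpow hNm.le, Real.rpow_neg hNm.le]
  have hnorm : ∀ m : ℕ, ∫ s in Ioi (0 : ℝ),
      ‖(s ^ α * Real.exp (-N * s) * Real.exp (-(m * s))) • b m‖ =
        Real.Gamma (1 + α) * (N + m) ^ (-(1 + α)) * ‖b m‖ := fun m => by
    rw [← (hI m).2, ← integral_mul_const]
    refine setIntegral_congr_fun measurableSet_Ioi fun s hs => ?_
    have hs0 : (0 : ℝ) < s := hs
    rw [norm_smul, Real.norm_of_nonneg (by positivity)]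
  have h := hasSum_integral_of_summable_integral_norm (μ := volume.restrict (Ioi (0 : ℝ)))
    (F := fun (m : ℕ) (s : ℝ) => (s ^ α * Real.exp (-N * s) * Real.exp (-(m * s))) • b m)
    (fun m => (hI m).1.smul_const _) (by
      simp_rw [hnorm]
      refine Summable.of_nonneg_of_le (fun m => by positivity) (fun m => ?_)
        (hb.mul_left (Real.Gamma (1 + α) * N ^ (-(1 + α))))
      refine mul_le_mul_of_nonneg_right (mul_le_mul_of_nonneg_left ?_ hG.le) (norm_nonneg _)
      exact Real.rpow_le_rpow_of_nonpos hN (by linarith [Nat.cast_nonneg (α := ℝ) m]) (by linarith))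
  simp_rw [integral_smul_const, fun m => (hI m).2, mul_smul] at h
  rw [← tsum_const_smul'', h.tsum_eq]
  refine setIntegral_congr_fun measurableSet_Ioi fun s hs => ?_
  simp only [mul_smul, expSeries]
  rw [tsum_const_smul'', tsum_const_smul'']

/-- The `n`th Fourier mode of `z ↦ D ^ (1 + α) φ (z) f(z̄)` is, on the circle `|z| = e ^ (-s / 2)`,
equal to `e ^ (-n s / 2)` times this function of `s`. -/
noncomputable def mode (α : ℝ) (a : ℕ → E →L[ℂ] E) (c : ℕ → E) (n : ℤ) (s : ℝ) : E :=
  expSeries (fun m => zeroExtend (rpowMul (1 + α) a) (n + m) (c m)) s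

/-- The contribution of the `n`th Fourier mode to the Carleson integral, up to the factor `π`. The
weight combines `1 - |z| ^ 2 = 1 - e ^ (-s)`, the area element and the factor `e ^ (-n s)`. -/
noncomputable def modeEnergy (α : ℝ) (a : ℕ → E →L[ℂ] E) (c : ℕ → E) (n : ℤ) : ℝ≥0∞ :=
  ∫⁻ s in Ioi (0 : ℝ), ENNReal.ofReal ((1 - Real.exp (-s)) * Real.exp (-(1 + (n : ℝ)) * s)) *
    ‖mode α a c n s‖ₑ ^ 2

/-- The energy of the derivative of the `n`th Fourier mode. By `hasDerivAt_mode` that derivative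
is, up to sign, the `n`th mode for the sequence `m c_m`, and is written in this form. -/
noncomputable def modeDerivEnergy (α : ℝ) (a : ℕ → E →L[ℂ] E) (c : ℕ → E) (n : ℤ) : ℝ≥0∞ :=
  ∫⁻ s in Ioi (0 : ℝ), ENNReal.ofReal (s ^ 3 * Real.exp (-n * s)) *
    ‖mode α a (fun m => (m : ℝ) • c m) n s‖ₑ ^ 2

variable {α : ℝ} {a : ℕ → E →L[ℂ] E} {c : ℕ → E}

theorem continuousOn_mode (ha : SubExp a) (hc : ExpDecay c) (n : ℤ) :
    ContinuousOn (mode α a c n) (Ioi 0) :=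
  continuousOn_expSeries (hc.zeroExtend_apply (ha.rpowMul _) n).summable_norm

theorem hasDerivAt_mode (ha : SubExp a) (hc : ExpDecay c) (n : ℤ) {s : ℝ} (hs : 0 < s) :
    HasDerivAt (mode α a c n) (-mode α a (fun m => (m : ℝ) • c m) n s) s := by
  have hb := hc.zeroExtend_apply (ha.rpowMul (1 + α)) n
  have h := hasDerivAt_expSeries hb.summable_norm hb.natCast_smul.summable_norm hs
  simpa only [mode, ContinuousLinearMap.map_smul_of_tower] using! h

/-- The average of the `n`th mode against `s ^ α e ^ (-(1 + n) s)` is a coefficient of `Γ_φ f`: the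
factors `(1 + n + m) ^ (-(1 + α))` from Euler's integral cancel those of `D ^ (1 + α)`. -/
theorem integral_mode (hα : 0 < α) (ha : SubExp a) (hc : ExpDecay c) (n : ℕ) :
    ∫ s in Ioi (0 : ℝ), (s ^ α * Real.exp (-(1 + (n : ℝ)) * s)) • mode α a c n s =
      Real.Gamma (1 + α) • hankelCoeff a c n := by
  have hb := hc.zeroExtend_apply (ha.rpowMul (1 + α)) n
  unfold mode
  rw [integral_rpow_mul_exp_smul_expSeries hα (by positivity) hb.summable_norm, hankelCoeff]
  congr 1
  refine tsum_congr fun m => ?_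
  have hp : (0 : ℝ) < 1 + n + m := by positivity
  rw [← Nat.cast_add, zeroExtend_natCast, rpowMul, smul_apply, Complex.coe_smul,
    smul_smul, add_comm m n, Nat.cast_add, ← add_assoc, ← Real.rpow_add hp]
  simp

/-- One coefficient of `D ^ α Γ_φ f` is controlled by one Fourier mode of the Carleson integral. -/
theorem hankelCoeff_sq_le_modeEnergy (hα : 0 < α) (ha : SubExp a) (hc : ExpDecay c) (n : ℕ) :
    (ENNReal.ofReal ((1 + (n : ℝ)) ^ α) * ‖hankelCoeff a c n‖ₑ) ^ 2 ≤
      ENNReal.ofReal ((Real.Gamma (2 * α + 1) + Real.Gamma (2 * α)) / Real.Gamma (1 + α) ^ 2) *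
        modeEnergy α a c n := by
  have hG := Real.Gamma_pos_of_pos (show 0 < 1 + α by linarith)
  have hN : (0 : ℝ) < 1 + n := by positivity
  have g1 := Real.Gamma_pos_of_pos (show 0 < 2 * α + 1 by positivity)
  have g2 := Real.Gamma_pos_of_pos (show 0 < 2 * α by positivity)
  have h := enorm_integral_rpow_mul_exp_sq_le (E := E) hα
    (show (1 : ℝ) ≤ 1 + n by linarith [Nat.cast_nonneg (α := ℝ) n]) (continuousOn_mode (α := α) ha hc n)
  rw [integral_mode hα ha hc] at h
  have h1 : (ENNReal.ofReal ((1 + (n : ℝ)) ^ α) * ‖hankelCoeff a c n‖ₑ) ^ 2 =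
      ENNReal.ofReal (((1 + (n : ℝ)) ^ α / Real.Gamma (1 + α)) ^ 2) *
        ‖Real.Gamma (1 + α) • hankelCoeff a c n‖ₑ ^ 2 := by
    rw [enorm_smul, Real.enorm_of_nonneg hG.le, mul_pow, mul_pow, ← mul_assoc,
      ← ENNReal.ofReal_pow hG.le, ← ENNReal.ofReal_mul (by positivity),
      ← ENNReal.ofReal_pow (by positivity)]
    congr 2
    field_simp
  rw [h1]
  refine (mul_le_mul_right h _).trans (le_of_eq ?_)
  rw [← mul_assoc, ← ENNReal.ofReal_mul (by positivity)]
  have h2 : ((1 + (n : ℝ)) ^ α) ^ 2 * (1 + (n : ℝ)) ^ (-(2 * α)) = 1 := by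
    rw [← Real.rpow_natCast, ← Real.rpow_mul hN.le, ← Real.rpow_add hN]
    have : α * ((2 : ℕ) : ℝ) + -(2 * α) = 0 := by push_cast; ring
    rw [this, Real.rpow_zero]
  have h3 : ((1 + (n : ℝ)) ^ α / Real.Gamma (1 + α)) ^ 2 *
      ((Real.Gamma (2 * α + 1) + Real.Gamma (2 * α)) * (1 + (n : ℝ)) ^ (-(2 * α))) =
      (Real.Gamma (2 * α + 1) + Real.Gamma (2 * α)) / Real.Gamma (1 + α) ^ 2 := by
    rw [div_pow]
    calc _ = (((1 + (n : ℝ)) ^ α) ^ 2 * (1 + (n : ℝ)) ^ (-(2 * α))) *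
        ((Real.Gamma (2 * α + 1) + Real.Gamma (2 * α)) / Real.Gamma (1 + α) ^ 2) := by ring
      _ = _ := by rw [h2, one_mul]
  rw [h3]
  simp only [modeEnergy, Int.cast_natCast]

theorem one_sub_exp_neg_le (s : ℝ) : 1 - Real.exp (-s) ≤ s := by
  linarith [Real.add_one_le_exp (-s)]

/-- For `n < 0` the mode has no constant term, hence vanishes at infinity, and is controlled by
its derivative alone. -/
theorem modeEnergy_le_of_neg (ha : SubExp a) (hc : ExpDecay c) {n : ℤ} (hn : n < 0) :
    modeEnergy α a c n ≤ modeDerivEnergy α a c n := by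
  have hb := hc.zeroExtend_apply (ha.rpowMul (1 + α)) n
  have hn' : (n : ℝ) + 1 ≤ 0 := by exact_mod_cast hn
  have hlim : Filter.Tendsto (mode α a c n) Filter.atTop (nhds 0) :=
    tendsto_expSeries hb.summable_norm (by
      simp [zeroExtend_of_neg _ hn])
  have h := hardy_of_tendsto_zero (fun s hs => hasDerivAt_mode (α := α) ha hc n hs)
    (continuousOn_mode ha hc.natCast_smul n).neg hlim (c := -(1 + (n : ℝ))) (by linarith)
  refine le_trans ?_ (h.trans ?_)
  · refine setLIntegral_mono' measurableSet_Ioi fun s hs => ?_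
    gcongr
    exact one_sub_exp_neg_le s
  · refine setLIntegral_mono' measurableSet_Ioi fun s hs => ?_
    have hs0 : (0 : ℝ) < s := hs
    rw [enorm_neg]
    gcongr
    linarith

theorem lintegral_mul_exp_neg {N : ℝ} (hN : 0 < N) :
    ∫⁻ s in Ioi (0 : ℝ), ENNReal.ofReal (s * Real.exp (-N * s)) = ENNReal.ofReal ((N ^ 2)⁻¹) := by
  have h := lintegral_rpow_mul_exp_neg_mul (a := 2) two_pos hN
  rw [Real.Gamma_two, mul_one, Real.rpow_two, one_div, inv_pow] at h
  rw [← h]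
  norm_num

/-- For `n ≥ 0` the derivative controls the mode up to a constant, which is compared with the
`n`th coefficient of `D ^ α Γ_φ f`. -/
theorem modeEnergy_le_of_nonneg (hα : 0 < α) (ha : SubExp a) (hc : ExpDecay c) (n : ℕ) :
    modeEnergy α a c n ≤
      ENNReal.ofReal (24 + 48 * ((Real.Gamma (2 * α + 1) + Real.Gamma (2 * α)) /
        Real.Gamma (1 + α) ^ 2)) * modeDerivEnergy α a c n +
      4 * (ENNReal.ofReal ((1 + (n : ℝ)) ^ α) * ‖hankelCoeff a c n‖ₑ) ^ 2 := by
  set N : ℝ := 1 + n with hNdef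
  set K : ℝ := Real.Gamma (2 * α + 1) + Real.Gamma (2 * α) with hK
  set g : ℝ := Real.Gamma (1 + α) with hg
  have hG : 0 < g := Real.Gamma_pos_of_pos (by linarith)
  have hN : 0 < N := by positivity
  have hN1 : 1 ≤ N := by rw [hNdef]; linarith [Nat.cast_nonneg (α := ℝ) n]
  have hK0 : 0 < K := add_pos (Real.Gamma_pos_of_pos (by positivity))
    (Real.Gamma_pos_of_pos (by positivity))
  set h := mode α a c n with hh
  set p := h N⁻¹ with hp
  have hcont : ContinuousOn h (Ioi 0) := continuousOn_mode ha hc n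
  set W : ℝ → ℝ := fun s => (1 - Real.exp (-s)) * Real.exp (-N * s) with hW
  set V := ∫⁻ s in Ioi (0 : ℝ), ENNReal.ofReal (W s) * ‖h s - p‖ₑ ^ 2 with hV
  -- The deviation of the mode from its value `p` at `1 / N`.
  have hVD : V ≤ 12 * modeDerivEnergy α a c n := by
    have h1 := hardy_sub_apply_inv (fun s hs => hasDerivAt_mode (α := α) ha hc n hs)
      (continuousOn_mode ha hc.natCast_smul n).neg hN
    refine le_trans ?_ (h1.trans ?_)
    · refine setLIntegral_mono' measurableSet_Ioi fun s hs => ?_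
      simp only [hW]
      gcongr
      exact one_sub_exp_neg_le s
    · refine mul_le_mul_right (setLIntegral_mono' measurableSet_Ioi fun s hs => ?_) _
      have hs0 : (0 : ℝ) < s := hs
      rw [enorm_neg, Int.cast_natCast]
      gcongr
      linarith
  -- The average of `h - p` against `s ^ α e ^ (-N s)` compares `p` with `N ^ (1 + α) γ_n`, where
  -- `γ_n` is the coefficient of `Γ_φ f`.
  have hav : ∫ s in Ioi (0 : ℝ), (s ^ α * Real.exp (-N * s)) • (h s - p) =
      (g * N ^ (-(1 + α))) • (N ^ (1 + α) • hankelCoeff a c n - p) := by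
    have hα1 : 0 < 1 + α := by linarith
    have h1 : ∀ s : ℝ, s ^ α * Real.exp (-N * s) = s ^ (1 + α - 1) * Real.exp (-(N * s)) := fun s => by
      rw [add_sub_cancel_left, neg_mul]
    have hint : IntegrableOn (fun s : ℝ => s ^ α * Real.exp (-N * s)) (Ioi 0) := by
      simp_rw [h1]
      exact integrableOn_rpow_mul_exp_neg_mul hα1 hN
    have hval : ∫ s in Ioi (0 : ℝ), s ^ α * Real.exp (-N * s) = g * N ^ (-(1 + α)) := by
      simp_rw [h1]
      rw [Real.integral_rpow_mul_exp_neg_mul_Ioi hα1 hN, one_div, Real.inv_rpow hN.le,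
        Real.rpow_neg hN.le, mul_comm]
    have hb := (hc.zeroExtend_apply (ha.rpowMul (1 + α)) n).summable_norm
    have hinth : IntegrableOn (fun s : ℝ => (s ^ α * Real.exp (-N * s)) • h s) (Ioi 0) := by
      refine Integrable.mono' (hint.mul_const
        (∑' m : ℕ, ‖zeroExtend (rpowMul (1 + α) a) ((n : ℤ) + m) (c m)‖))
        (hint.aestronglyMeasurable.smul (hcont.aestronglyMeasurable measurableSet_Ioi)) ?_
      filter_upwards [ae_restrict_mem measurableSet_Ioi] with s hs
      have hs0 : (0 : ℝ) < s := hs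
      rw [norm_smul, Real.norm_of_nonneg (by positivity)]
      gcongr
      exact tsum_of_norm_bounded hb.hasSum fun m =>
        norm_exp_smul_le (fun m : ℕ => zeroExtend (rpowMul (1 + α) a) ((n : ℤ) + m) (c m)) hs0.le m
    simp_rw [smul_sub]
    rw [integral_sub hinth (hint.smul_const p), integral_smul_const, hval, hh, hNdef,
      integral_mode hα ha hc, smul_smul, mul_assoc, ← Real.rpow_add (by positivity),
      neg_add_cancel, Real.rpow_zero, mul_one]
  have hdev : ENNReal.ofReal ((N ^ 2)⁻¹) * ‖N ^ (1 + α) • hankelCoeff a c n - p‖ₑ ^ 2 ≤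
      ENNReal.ofReal (K / g ^ 2) * V := by
    have h1 := enorm_integral_rpow_mul_exp_sq_le (E := E) hα hN1 (hcont.sub (continuousOn_const (c := p)))
    simp only [Pi.sub_apply] at h1
    rw [hav, enorm_smul, Real.enorm_of_nonneg (by positivity), mul_pow,
      ← ENNReal.ofReal_pow (by positivity)] at h1
    have h2 : (N ^ 2)⁻¹ = (N ^ (2 * α) / g ^ 2) * (g * N ^ (-(1 + α))) ^ 2 := by
      have : (N ^ (-(1 + α))) ^ 2 = N ^ (-(2 * α)) * (N ^ 2)⁻¹ := by
        rw [← Real.rpow_natCast, ← Real.rpow_mul hN.le, ← Real.rpow_natCast, ← Real.rpow_neg hN.le,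
          ← Real.rpow_add hN]
        congr 1
        push_cast
        ring
      rw [mul_pow, this, Real.rpow_neg hN.le]
      field_simp
    have h3 : K / g ^ 2 = (N ^ (2 * α) / g ^ 2) * (K * N ^ (-(2 * α))) := by
      rw [Real.rpow_neg hN.le]
      field_simp
    rw [h2, h3, ENNReal.ofReal_mul (by positivity), ENNReal.ofReal_mul (p := N ^ (2 * α) / g ^ 2)
      (by positivity), mul_assoc, mul_assoc]
    exact mul_le_mul_right h1 _
  have hQ : ENNReal.ofReal ((N ^ 2)⁻¹) * ‖N ^ (1 + α) • hankelCoeff a c n‖ₑ ^ 2 =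
      (ENNReal.ofReal (N ^ α) * ‖hankelCoeff a c n‖ₑ) ^ 2 := by
    rw [enorm_smul, Real.enorm_of_nonneg (by positivity), mul_pow, mul_pow, ← mul_assoc,
      ← ENNReal.ofReal_pow (by positivity), ← ENNReal.ofReal_pow (by positivity),
      ← ENNReal.ofReal_mul (by positivity), Real.rpow_one_add' hN.le (by positivity)]
    congr 2
    field_simp
  have hpb : ENNReal.ofReal ((N ^ 2)⁻¹) * ‖p‖ₑ ^ 2 ≤ 2 * (ENNReal.ofReal (K / g ^ 2) * V +
      (ENNReal.ofReal (N ^ α) * ‖hankelCoeff a c n‖ₑ) ^ 2) := by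
    set Q := N ^ (1 + α) • hankelCoeff a c n with hQdef
    have h1 := enorm_add_sq_le (p - Q) Q
    rw [sub_add_cancel, ← enorm_neg (p - Q), neg_sub] at h1
    refine (mul_le_mul_right h1 _).trans ?_
    rw [mul_left_comm, mul_add, hQ]
    gcongr
  have hWi : ∫⁻ s in Ioi (0 : ℝ), ENNReal.ofReal (W s) ≤ ENNReal.ofReal ((N ^ 2)⁻¹) := by
    rw [← lintegral_mul_exp_neg hN]
    refine setLIntegral_mono' measurableSet_Ioi fun s hs => ?_
    simp only [hW]
    gcongr
    exact one_sub_exp_neg_le s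
  have hWm : Measurable fun s => ENNReal.ofReal (W s) := by fun_prop
  have hm : AEMeasurable (fun s => ENNReal.ofReal (W s) * ‖h s - p‖ₑ ^ 2)
      (volume.restrict (Ioi 0)) :=
    hWm.aemeasurable.mul (aemeasurable_enorm_sq measurableSet_Ioi (hcont.sub continuousOn_const))
  calc modeEnergy α a c n
      ≤ ∫⁻ s in Ioi (0 : ℝ), (2 * (ENNReal.ofReal (W s) * ‖h s - p‖ₑ ^ 2) +
          2 * (ENNReal.ofReal (W s) * ‖p‖ₑ ^ 2)) := by
        refine setLIntegral_mono' measurableSet_Ioi fun s hs => ?_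
        have h1 := enorm_add_sq_le (h s - p) p
        rw [sub_add_cancel] at h1
        rw [Int.cast_natCast, ← mul_add, ← mul_add, mul_left_comm]
        exact mul_le_mul_right h1 _
    _ = 2 * V + 2 * ((∫⁻ s in Ioi (0 : ℝ), ENNReal.ofReal (W s)) * ‖p‖ₑ ^ 2) := by
        rw [lintegral_add_left' (hm.const_mul 2), lintegral_const_mul' _ _ (by simp),
          lintegral_const_mul' _ _ (by simp), lintegral_mul_const _ hWm]
    _ ≤ 2 * V + 2 * (2 * (ENNReal.ofReal (K / g ^ 2) * V +
          (ENNReal.ofReal (N ^ α) * ‖hankelCoeff a c n‖ₑ) ^ 2)) := by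
        exact add_le_add_right (mul_le_mul_right ((mul_le_mul_left hWi _).trans hpb) _) _
    _ = (2 + 4 * ENNReal.ofReal (K / g ^ 2)) * V +
          4 * (ENNReal.ofReal (N ^ α) * ‖hankelCoeff a c n‖ₑ) ^ 2 := by ring
    _ ≤ (2 + 4 * ENNReal.ofReal (K / g ^ 2)) * (12 * modeDerivEnergy α a c n) +
          4 * (ENNReal.ofReal (N ^ α) * ‖hankelCoeff a c n‖ₑ) ^ 2 := by gcongr
    _ = _ := by
        rw [ENNReal.ofReal_add (by positivity) (by positivity), ENNReal.ofReal_mul (by positivity),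
          ENNReal.ofReal_ofNat, ENNReal.ofReal_ofNat]
        ring

end Energy

/-! ### Summation over the Fourier modes -/

section Totals

variable {E : Type*} [NormedAddCommGroup E] [InnerProductSpace ℂ E] [CompleteSpace E]
  {α : ℝ} {a : ℕ → E →L[ℂ] E} {c : ℕ → E}

/-- The Carleson integral controls `D ^ α Γ_φ f`. -/
theorem tsum_hankelCoeff_sq_le (hα : 0 < α) (ha : SubExp a) (hc : ExpDecay c) :
    ∑' n : ℕ, (ENNReal.ofReal ((1 + (n : ℝ)) ^ α) * ‖hankelCoeff a c n‖ₑ) ^ 2 ≤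
      ENNReal.ofReal ((Real.Gamma (2 * α + 1) + Real.Gamma (2 * α)) / Real.Gamma (1 + α) ^ 2) *
        ∑' n : ℤ, modeEnergy α a c n := by
  rw [← ENNReal.tsum_mul_left]
  refine le_trans (ENNReal.tsum_le_tsum fun n => hankelCoeff_sq_le_modeEnergy hα ha hc n) ?_
  exact ENNReal.tsum_comp_le_tsum_of_injective (f := fun n : ℕ => (n : ℤ)) Nat.cast_injective
    (fun n : ℤ => ENNReal.ofReal ((Real.Gamma (2 * α + 1) + Real.Gamma (2 * α)) /
      Real.Gamma (1 + α) ^ 2) * modeEnergy α a c n)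

/-- Parseval's identity together with the pointwise bound for `D ^ (1 + α) φ`. -/
theorem tsum_exp_mul_mode_sq_le (hα : 0 < α) (ha : SubExp a) (hc : ExpDecay c) {B : ℝ≥0∞}
    (hB : ∀ c : ℕ → E, ExpDecay c →
      ∑' n : ℕ, (ENNReal.ofReal ((1 + (n : ℝ)) ^ α) * ‖hankelCoeff a c n‖ₑ) ^ 2 ≤
        B * ∑' m, ‖c m‖ₑ ^ 2) {s : ℝ} (hs : 0 < s) :
    ∑' n : ℤ, ENNReal.ofReal (Real.exp (-n * s)) * ‖mode α a c n s‖ₑ ^ 2 ≤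
      ENNReal.ofReal (((1 + α) * (1 - Real.exp (-s))⁻¹) ^ 2) * B *
        ∑' m : ℕ, ENNReal.ofReal (Real.exp (-(m * s))) * ‖c m‖ₑ ^ 2 := by
  have hr0 := Real.exp_nonneg (-s / 2)
  have hr1 : Real.exp (-s / 2) < 1 := Real.exp_lt_one_iff.2 (by linarith)
  have hr2 : Real.exp (-s / 2) ^ 2 = Real.exp (-s) := by
    rw [← Real.exp_nat_mul]
    congr 1
    push_cast
    ring
  have hpi : ENNReal.ofReal (2 * Real.pi) ≠ 0 := by
    simpa using Real.pi_pos
  refine (ENNReal.mul_le_mul_iff_right hpi ENNReal.ofReal_ne_top).1 ?_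
  simp only [mode]
  rw [← lintegral_enorm_mul_conj_sq_exp 0 hs (ha.rpowMul _) hc]
  have h2 := lintegral_enorm_tsum_conj_pow_sq 0 hr0 (hc.summable_mul_pow hr0 hr1.le)
  have h3 : ∀ m : ℕ, Real.exp (-s / 2) ^ (2 * m) = Real.exp (-(m * s)) := fun m => by
    rw [pow_mul, hr2, ← Real.exp_nat_mul]
    congr 1
    ring
  simp_rw [h3] at h2
  rw [mul_left_comm, ← h2, ← lintegral_const_mul'']
  · refine lintegral_mono fun θ => ?_
    have hz : ‖circleMap 0 (Real.exp (-s / 2)) θ‖ < 1 := by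
      rwa [norm_circleMap_zero, abs_of_nonneg hr0]
    have h4 := enorm_tsum_smul_apply_sq_le hα ha hB hz
      (∑' m : ℕ, conj (circleMap 0 (Real.exp (-s / 2)) θ) ^ m • c m)
    rw [norm_circleMap_zero, abs_of_nonneg hr0, hr2] at h4
    simpa only [rpowMul, smul_smul] using h4
  · refine ((continuous_enorm.comp (continuous_tsum (fun m => ?_)
      (hc.summable_mul_pow hr0 hr1.le) fun m θ => ?_)).measurable.pow_const 2).aemeasurable
    · exact ((Complex.continuous_conj.comp (continuous_circleMap 0 _)).pow m).smul continuous_const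
    · rw [norm_smul, norm_pow, RCLike.norm_conj, norm_circleMap_zero, abs_of_nonneg hr0, mul_comm]

/-- The `s`-integral of the squared pointwise bound against the weight `s ^ 3 e ^ (-m s)` is of
order `m ^ (-2)`, which compensates for the factor `m` in the coefficients `m c_m` of the
derivative. -/
theorem lintegral_cube_mul_inv_sq_mul_exp_le (m : ℕ) :
    ENNReal.ofReal ((m : ℝ) ^ 2) * ∫⁻ s in Ioi (0 : ℝ),
      ENNReal.ofReal (s ^ 3 * ((1 - Real.exp (-s))⁻¹) ^ 2 * Real.exp (-(m * s))) ≤ 14 := by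
  rcases Nat.eq_zero_or_pos m with rfl | hm
  · simp
  have hm0 : (0 : ℝ) < m := by exact_mod_cast hm
  have hm1 : (1 : ℝ) ≤ m := by exact_mod_cast hm
  have hle : ∫⁻ s in Ioi (0 : ℝ),
      ENNReal.ofReal (s ^ 3 * ((1 - Real.exp (-s))⁻¹) ^ 2 * Real.exp (-(m * s))) ≤
      ∫⁻ s in Ioi (0 : ℝ), (2 * ENNReal.ofReal (s ^ ((4 : ℝ) - 1) * Real.exp (-(m * s))) +
        2 * ENNReal.ofReal (s ^ ((2 : ℝ) - 1) * Real.exp (-(m * s)))) := by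
    refine setLIntegral_mono' measurableSet_Ioi fun s hs => ?_
    have hs0 : (0 : ℝ) < s := hs
    have h1 := inv_one_sub_exp_neg_le hs0
    have h0 : 0 ≤ (1 - Real.exp (-s))⁻¹ :=
      inv_nonneg.2 (by linarith [Real.exp_lt_one_iff.2 (neg_lt_zero.2 hs0)])
    rw [← mul_add, ← ENNReal.ofReal_add (by positivity) (by positivity), ← ENNReal.ofReal_ofNat 2,
      ← ENNReal.ofReal_mul (by norm_num)]
    apply ENNReal.ofReal_le_ofReal
    have e3 : s ^ ((4 : ℝ) - 1) = s ^ 3 := by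
      rw [← Real.rpow_natCast]; norm_num
    have e1 : s ^ ((2 : ℝ) - 1) = s := by norm_num
    rw [e3, e1]
    calc s ^ 3 * ((1 - Real.exp (-s))⁻¹) ^ 2 * Real.exp (-(m * s))
        ≤ s ^ 3 * (1 + s⁻¹) ^ 2 * Real.exp (-(m * s)) := by gcongr
      _ = (s ^ 3 + 2 * s ^ 2 + s) * Real.exp (-(m * s)) := by
          field_simp
          ring
      _ ≤ (2 * (s ^ 3 + s)) * Real.exp (-(m * s)) := by
          gcongr
          nlinarith [mul_nonneg hs0.le (sq_nonneg (s - 1))]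
      _ = _ := by ring
  refine (mul_le_mul_right hle _).trans ?_
  rw [lintegral_add_left (by fun_prop), lintegral_const_mul' _ _ (by simp),
    lintegral_const_mul' _ _ (by simp), lintegral_rpow_mul_exp_neg_mul (by norm_num) hm0,
    lintegral_rpow_mul_exp_neg_mul (by norm_num) hm0, ← mul_add,
    ← ENNReal.ofReal_add (by positivity) (by positivity), ← ENNReal.ofReal_ofNat 2,
    ← ENNReal.ofReal_mul (by norm_num), ← ENNReal.ofReal_mul (by positivity),
    ← ENNReal.ofReal_ofNat 14]
  apply ENNReal.ofReal_le_ofReal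
  have g4 : Real.Gamma 4 = 6 := by
    have h := Real.Gamma_nat_eq_factorial 3
    rw [show ((3 : ℕ) : ℝ) + 1 = 4 by norm_num] at h
    rw [h]
    norm_num [Nat.factorial]
  have e4 : (1 / (m : ℝ)) ^ (4 : ℝ) = ((m : ℝ) ^ 4)⁻¹ := by
    rw [one_div, ← inv_pow, ← Real.rpow_natCast]; norm_num
  have e2 : (1 / (m : ℝ)) ^ (2 : ℝ) = ((m : ℝ) ^ 2)⁻¹ := by
    rw [one_div, ← inv_pow, ← Real.rpow_natCast]; norm_num
  rw [g4, Real.Gamma_two, e4, e2]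
  have h5 : ((m : ℝ) ^ 2)⁻¹ ≤ 1 := inv_le_one_of_one_le₀ (one_le_pow₀ hm1)
  calc _ = 12 * ((m : ℝ) ^ 2)⁻¹ + 2 := by field_simp; ring
    _ ≤ _ := by linarith

/-- Boundedness of `D ^ α Γ_φ` controls the derivatives of all modes. -/
theorem tsum_modeDerivEnergy_le (hα : 0 < α) (ha : SubExp a) (hc : ExpDecay c) {B : ℝ≥0∞}
    (hB : ∀ c : ℕ → E, ExpDecay c →
      ∑' n : ℕ, (ENNReal.ofReal ((1 + (n : ℝ)) ^ α) * ‖hankelCoeff a c n‖ₑ) ^ 2 ≤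
        B * ∑' m, ‖c m‖ₑ ^ 2) :
    ∑' n : ℤ, modeDerivEnergy α a c n ≤
      ENNReal.ofReal (14 * (1 + α) ^ 2) * (B * ∑' m, ‖c m‖ₑ ^ 2) := by
  have hc' := hc.natCast_smul
  simp only [modeDerivEnergy]
  have hm : ∀ n : ℤ, AEMeasurable (fun s : ℝ => ENNReal.ofReal (s ^ 3 * Real.exp (-n * s)) *
      ‖mode α a (fun m => (m : ℝ) • c m) n s‖ₑ ^ 2) (volume.restrict (Ioi 0)) := fun n =>
    (by fun_prop : Measurable fun s : ℝ =>
      ENNReal.ofReal (s ^ 3 * Real.exp (-n * s))).aemeasurable.mul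
      (aemeasurable_enorm_sq measurableSet_Ioi (continuousOn_mode ha hc' n))
  rw [← lintegral_tsum hm]
  set w : ℕ → ℝ → ℝ≥0∞ := fun m s =>
    ENNReal.ofReal (s ^ 3 * ((1 - Real.exp (-s))⁻¹) ^ 2 * Real.exp (-(m * s))) with hw
  calc _ ≤ ∫⁻ s in Ioi (0 : ℝ), ∑' m : ℕ, (ENNReal.ofReal ((1 + α) ^ 2) * B *
          ‖(m : ℝ) • c m‖ₑ ^ 2) * w m s := by
        refine setLIntegral_mono' measurableSet_Ioi fun s hs => ?_
        have hs0 : (0 : ℝ) < s := hs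
        have h1 := tsum_exp_mul_mode_sq_le hα ha hc' hB hs0
        have h2 : 0 ≤ (1 - Real.exp (-s))⁻¹ :=
          inv_nonneg.2 (by linarith [Real.exp_lt_one_iff.2 (neg_lt_zero.2 hs0)])
        calc _ = ENNReal.ofReal (s ^ 3) * ∑' n : ℤ, ENNReal.ofReal (Real.exp (-n * s)) *
              ‖mode α a (fun m => (m : ℝ) • c m) n s‖ₑ ^ 2 := by
              rw [← ENNReal.tsum_mul_left]
              refine tsum_congr fun n => ?_
              rw [ENNReal.ofReal_mul (by positivity), mul_assoc]
          _ ≤ _ := mul_le_mul_right h1 _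
          _ = _ := by
              rw [← ENNReal.tsum_mul_left, ← ENNReal.tsum_mul_left]
              refine tsum_congr fun m => ?_
              simp only [hw]
              rw [ENNReal.ofReal_mul (by positivity), ENNReal.ofReal_mul (by positivity), mul_pow,
                ENNReal.ofReal_mul (by positivity)]
              ring
    _ = ∑' m : ℕ, (ENNReal.ofReal ((1 + α) ^ 2) * B * ‖(m : ℝ) • c m‖ₑ ^ 2) *
          ∫⁻ s in Ioi (0 : ℝ), w m s := by
        have hwm : ∀ m, Measurable (w m) := fun m => by
          simp only [hw]
          fun_prop
        rw [lintegral_tsum fun m => ((hwm m).const_mul _).aemeasurable]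
        exact tsum_congr fun m => lintegral_const_mul _ (hwm m)
    _ ≤ ∑' m : ℕ, ENNReal.ofReal (14 * (1 + α) ^ 2) * (B * ‖c m‖ₑ ^ 2) := by
        refine ENNReal.tsum_le_tsum fun m => ?_
        have h3 := lintegral_cube_mul_inv_sq_mul_exp_le m
        rw [enorm_smul, mul_pow, Real.enorm_of_nonneg (by positivity),
          ← ENNReal.ofReal_pow (by positivity), ENNReal.ofReal_mul (by positivity)]
        calc _ = ENNReal.ofReal ((1 + α) ^ 2) * (B * ‖c m‖ₑ ^ 2) *
              (ENNReal.ofReal ((m : ℝ) ^ 2) * ∫⁻ s in Ioi (0 : ℝ), w m s) := by ring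
          _ ≤ ENNReal.ofReal ((1 + α) ^ 2) * (B * ‖c m‖ₑ ^ 2) * 14 := mul_le_mul_right h3 _
          _ = _ := by rw [ENNReal.ofReal_ofNat]; ring
    _ = _ := by rw [ENNReal.tsum_mul_left, ENNReal.tsum_mul_left]

/-- The constant in the bound of the Carleson integral by the norm of `D ^ α Γ_φ`. -/
noncomputable def carlesonConst (α : ℝ) : ℝ :=
  (24 + 48 * ((Real.Gamma (2 * α + 1) + Real.Gamma (2 * α)) / Real.Gamma (1 + α) ^ 2)) *
    (14 * (1 + α) ^ 2) + 4

/-- Boundedness of `D ^ α Γ_φ` controls the Carleson integral. -/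
theorem tsum_modeEnergy_le (hα : 0 < α) (ha : SubExp a) (hc : ExpDecay c) {B : ℝ≥0∞}
    (hB : ∀ c : ℕ → E, ExpDecay c →
      ∑' n : ℕ, (ENNReal.ofReal ((1 + (n : ℝ)) ^ α) * ‖hankelCoeff a c n‖ₑ) ^ 2 ≤
        B * ∑' m, ‖c m‖ₑ ^ 2) :
    ∑' n : ℤ, modeEnergy α a c n ≤ ENNReal.ofReal (carlesonConst α) * (B * ∑' m, ‖c m‖ₑ ^ 2) := by
  set C : ℝ := 24 + 48 * ((Real.Gamma (2 * α + 1) + Real.Gamma (2 * α)) /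
    Real.Gamma (1 + α) ^ 2) with hC
  have hC1 : 1 ≤ C := by
    have g1 := Real.Gamma_pos_of_pos (show 0 < 2 * α + 1 by positivity)
    have g2 := Real.Gamma_pos_of_pos (show 0 < 2 * α by positivity)
    have : 0 ≤ (Real.Gamma (2 * α + 1) + Real.Gamma (2 * α)) / Real.Gamma (1 + α) ^ 2 := by
      positivity
    linarith
  -- The contribution of the coefficients of `D ^ α Γ_φ f`, present for `0 ≤ n` only.
  set t : ℤ → ℝ≥0∞ := fun n => if 0 ≤ n then 4 * (ENNReal.ofReal ((1 + (n.toNat : ℝ)) ^ α) *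
    ‖hankelCoeff a c n.toNat‖ₑ) ^ 2 else 0 with ht
  have htsum : ∑' n : ℤ, t n ≤ 4 * (B * ∑' m, ‖c m‖ₑ ^ 2) := by
    rw [← Nat.cast_injective.tsum_eq (f := t)]
    · simp only [ht, Nat.cast_nonneg, if_true, Int.toNat_natCast]
      rw [ENNReal.tsum_mul_left]
      exact mul_le_mul_right (hB c hc) _
    · intro n hn
      refine ⟨n.toNat, Int.toNat_of_nonneg ?_⟩
      by_contra h
      exact hn (by simp only [ht, if_neg h])
  have hmode : ∀ n : ℤ, modeEnergy α a c n ≤ ENNReal.ofReal C * modeDerivEnergy α a c n + t n := by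
    intro n
    rcases lt_or_ge n 0 with hn | hn
    · refine (modeEnergy_le_of_neg ha hc hn).trans (le_add_right ?_)
      exact le_mul_of_one_le_left zero_le (ENNReal.one_le_ofReal.2 hC1)
    · lift n to ℕ using hn
      simpa only [ht, Nat.cast_nonneg, if_true, Int.toNat_natCast] using
        modeEnergy_le_of_nonneg hα ha hc n
  calc _ ≤ ∑' n : ℤ, (ENNReal.ofReal C * modeDerivEnergy α a c n + t n) :=
        ENNReal.tsum_le_tsum hmode
    _ = ENNReal.ofReal C * ∑' n : ℤ, modeDerivEnergy α a c n + ∑' n : ℤ, t n := by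
        rw [ENNReal.tsum_add, ENNReal.tsum_mul_left]
    _ ≤ ENNReal.ofReal C * (ENNReal.ofReal (14 * (1 + α) ^ 2) * (B * ∑' m, ‖c m‖ₑ ^ 2)) +
          4 * (B * ∑' m, ‖c m‖ₑ ^ 2) := by
        gcongr
        exact tsum_modeDerivEnergy_le hα ha hc hB
    _ = _ := by
        have hC0 : 0 ≤ C := by linarith
        rw [carlesonConst, ← hC, ENNReal.ofReal_add (p := C * _)
          (mul_nonneg hC0 (by positivity)) (by norm_num), ENNReal.ofReal_mul hC0,
          ENNReal.ofReal_ofNat]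
        ring

end Totals

/-! ### Taylor coefficients of vector-valued analytic functions -/

section PowerSeries

variable {Y : Type*} [NormedAddCommGroup Y] [NormedSpace ℂ Y]

/-- The sum of a power series with vector coefficients. -/
noncomputable def powerSum (v : ℕ → Y) (z : ℂ) : Y :=
  ∑' n : ℕ, z ^ n • v n

theorem taylorCoeff_congr {f g : ℂ → Y} (h : EqOn f g (ball 0 1)) (n : ℕ) :
    taylorCoeff f n = taylorCoeff g n := by
  rw [taylorCoeff, taylorCoeff, Filter.EventuallyEq.iteratedDeriv_eq n
    (h.eventuallyEq_of_mem (ball_mem_nhds 0 one_pos))]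

theorem HolExt.subset_hol : HolExt Y ⊆ Hol Y := by
  rintro f ⟨R, hR, g, hg, hfg⟩
  exact (hg.mono (ball_subset_ball hR.le)).congr hfg

variable [CompleteSpace Y]

theorem hasSum_taylorCoeff {f : ℂ → Y} {R : ℝ} (hf : DifferentiableOn ℂ f (ball 0 R)) {z : ℂ}
    (hz : z ∈ ball 0 R) : HasSum (fun n => z ^ n • taylorCoeff f n) (f z) := by
  have h := Complex.hasSum_taylorSeries_on_ball hf hz
  simp only [sub_zero] at h
  refine h.congr_fun fun n => ?_
  rw [taylorCoeff, smul_comm]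

theorem summable_norm_taylorCoeff {f : ℂ → Y} {R : ℝ} (hf : DifferentiableOn ℂ f (ball 0 R)) {r : ℝ}
    (h0 : 0 < r) (hr : r < R) : Summable fun n => ‖taylorCoeff f n‖ * r ^ n := by
  obtain ⟨ρ, hρ, hρR⟩ := exists_between hr
  have hρ0 : 0 < ρ := h0.trans hρ
  have hz : (ρ : ℂ) ∈ ball (0 : ℂ) R := by
    simpa [abs_of_pos hρ0] using hρR
  have ht := (hasSum_taylorCoeff hf hz).summable.tendsto_atTop_zero.norm
  obtain ⟨K, hK⟩ := ht.bddAbove_range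
  refine Summable.of_nonneg_of_le (fun n => by positivity) (fun n => ?_)
    ((summable_geometric_of_lt_one (r := r / ρ) (by positivity)
      ((div_lt_one hρ0).2 hρ)).mul_left K)
  have h1 : ‖(ρ : ℂ) ^ n • taylorCoeff f n‖ ≤ K := hK (mem_range_self n)
  rw [norm_smul, norm_pow, Complex.norm_real, Real.norm_of_nonneg hρ0.le] at h1
  calc ‖taylorCoeff f n‖ * r ^ n = (ρ ^ n * ‖taylorCoeff f n‖) * (r / ρ) ^ n := by
        rw [div_pow]; field_simp
    _ ≤ _ := by gcongr

theorem subExp_taylorCoeff {f : ℂ → Y} (hf : f ∈ Hol Y) : SubExp (taylorCoeff f) :=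
  fun _ h0 h1 => summable_norm_taylorCoeff hf h0 h1

theorem eqOn_powerSum_taylorCoeff {f : ℂ → Y} (hf : f ∈ Hol Y) :
    EqOn f (powerSum (taylorCoeff f)) (ball 0 1) :=
  fun _ hz => (hasSum_taylorCoeff hf hz).tsum_eq.symm

theorem expDecay_taylorCoeff {f : ℂ → Y} (hf : f ∈ HolExt Y) : ExpDecay (taylorCoeff f) := by
  obtain ⟨R, hR, g, hg, hfg⟩ := hf
  obtain ⟨r, hr, hrR⟩ := exists_between hR
  refine ⟨r, hr, ?_⟩
  simp_rw [taylorCoeff_congr hfg]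
  exact summable_norm_taylorCoeff hg (one_pos.trans hr) hrR

variable {v : ℕ → Y}

theorem SubExp.summable (hv : SubExp v) {z : ℂ} (hz : ‖z‖ < 1) :
    Summable fun n => z ^ n • v n := by
  obtain ⟨r, hr, hr1⟩ := exists_between hz
  refine Summable.of_norm_bounded (hv r ((norm_nonneg z).trans_lt hr) hr1) fun n => ?_
  rw [norm_smul, norm_pow, mul_comm]
  gcongr

theorem hasDerivAt_powerSum (hv : SubExp v) {z : ℂ} (hz : ‖z‖ < 1) :
    HasDerivAt (powerSum v) (∑' n : ℕ, ((n : ℂ) * z ^ (n - 1)) • v n) z := by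
  obtain ⟨r, hr, hr1⟩ := exists_between hz
  have hr0 : 0 < r := (norm_nonneg z).trans_lt hr
  have hs : SubExp fun n : ℕ => (n : ℂ) • v n := hv.of_norm_le 1 fun n => by
    rw [norm_smul, Real.rpow_one, Complex.norm_natCast]
    gcongr
    linarith
  refine hasDerivAt_tsum_of_isPreconnected (t := ball (0 : ℂ) r)
    (g := fun (n : ℕ) (z : ℂ) => z ^ n • v n)
    (g' := fun (n : ℕ) (z : ℂ) => ((n : ℂ) * z ^ (n - 1)) • v n)
    ((hs r hr0 hr1).mul_left r⁻¹) isOpen_ball (convex_ball _ _).isPreconnected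
    (fun n w _ => (hasDerivAt_pow n w).smul_const (v n)) (fun n w hw => ?_)
    (mem_ball_self hr0) (hv.summable (by simp)) (by simpa using hr)
  have hw' : ‖w‖ ≤ r := le_of_lt (by simpa using hw)
  rw [norm_smul, norm_mul, norm_smul, norm_pow]
  rcases n with _ | n
  · simp
  · calc _ ≤ ‖((n + 1 : ℕ) : ℂ)‖ * r ^ (n + 1 - 1) * ‖v (n + 1)‖ := by gcongr
      _ = _ := by
        rw [Nat.add_sub_cancel, pow_succ]
        field_simp

theorem powerSum_mem_hol (hv : SubExp v) : powerSum v ∈ Hol Y := fun _ hz =>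
  (hasDerivAt_powerSum hv (by simpa using hz)).differentiableAt.differentiableWithinAt

theorem diffOp_powerSum (hv : SubExp v) {z : ℂ} (hz : ‖z‖ < 1) :
    diffOp (powerSum v) z = ∑' n : ℕ, (z ^ n * (1 + (n : ℂ))) • v n := by
  have hs : SubExp fun n : ℕ => (n : ℂ) • v n := hv.of_norm_le 1 fun n => by
    rw [norm_smul, Real.rpow_one, Complex.norm_natCast]
    gcongr
    linarith
  rw [diffOp, (hasDerivAt_powerSum hv hz).deriv, powerSum, ← tsum_const_smul'', add_comm]
  have h1 : ∀ n : ℕ, z • ((n : ℂ) * z ^ (n - 1)) • v n = z ^ n • (n : ℂ) • v n := fun n => by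
    rcases n with _ | n
    · simp
    · rw [smul_smul, smul_smul, Nat.add_sub_cancel, pow_succ]
      congr 1
      ring
  simp_rw [h1]
  rw [← (hv.summable hz).tsum_add (hs.summable hz)]
  refine tsum_congr fun n => ?_
  rw [smul_smul, ← add_smul]
  congr 1
  ring

theorem taylorCoeff_powerSum (hv : SubExp v) (n : ℕ) : taylorCoeff (powerSum v) n = v n := by
  set p : FormalMultilinearSeries ℂ ℂ Y := fun n =>
    ContinuousMultilinearMap.mkPiRing ℂ (Fin n) (v n) with hp
  have hF : HasFPowerSeriesOnBall (powerSum v) p 0 ((2⁻¹ : ℝ≥0) : ℝ≥0∞) := by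
    refine ⟨?_, by simp, fun {y} hy => ?_⟩
    · refine p.le_radius_of_summable_norm ?_
      simp only [hp, ContinuousMultilinearMap.norm_mkPiRing]
      exact hv _ (by norm_num) (by norm_num)
    · have hy1 : ‖y‖ < 1 := by
        rw [Metric.eball_coe, mem_ball_zero_iff] at hy
        exact hy.trans (by norm_num)
      rw [zero_add]
      have := (hv.summable hy1).hasSum
      simpa [hp] using! this
  have h := hF.factorial_smul 1 n
  rw [taylorCoeff, iteratedDeriv_eq_iteratedFDeriv, ← h]
  simp only [hp, ContinuousMultilinearMap.mkPiRing_apply, Finset.prod_const_one, one_smul]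
  rw [← Nat.cast_smul_eq_nsmul ℂ, smul_smul, inv_mul_cancel₀, one_smul]
  exact_mod_cast n.factorial_ne_zero

theorem powerSum_mem_holExt (hv : ExpDecay v) : powerSum v ∈ HolExt Y := by
  obtain ⟨R, hR, hs⟩ := hv
  have hR0 : 0 < R := one_pos.trans hR
  have hsub : SubExp fun n => ((R : ℂ) ^ n) • v n := by
    intro r h0 h1
    refine Summable.of_nonneg_of_le (fun n => by positivity) (fun n => ?_) hs
    rw [norm_smul, norm_pow, Complex.norm_real, Real.norm_of_nonneg hR0.le, mul_comm (R ^ n)]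
    exact mul_le_of_le_one_right (by positivity) (pow_le_one₀ h0.le h1.le)
  refine ⟨R, hR, powerSum v, ?_, fun _ _ => rfl⟩
  have h1 : powerSum v = fun z => powerSum (fun n => ((R : ℂ) ^ n) • v n) (z / R) := by
    funext z
    refine tsum_congr fun n => ?_
    rw [smul_smul, div_pow, div_mul_cancel₀]
    exact pow_ne_zero _ (by exact_mod_cast hR0.ne')
  rw [h1]
  refine DifferentiableOn.comp (t := ball 0 1) (powerSum_mem_hol hsub) (by fun_prop) fun z hz => ?_
  rw [mem_ball_zero_iff] at hz ⊢
  rw [norm_div, Complex.norm_real, Real.norm_of_nonneg hR0.le, div_lt_one hR0]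
  exact hz

end PowerSeries

/-! ### The `H ^ 2` norm in terms of Taylor coefficients -/

section HardyNorm

theorem sq_rpow_half (x : ℝ≥0∞) : (x ^ 2) ^ (1 / 2 : ℝ) = x := by
  rw [← ENNReal.rpow_two, ← ENNReal.rpow_mul]
  norm_num

theorem rpow_half_sq (x : ℝ≥0∞) : (x ^ (1 / 2 : ℝ)) ^ 2 = x := by
  rw [← ENNReal.rpow_two, ← ENNReal.rpow_mul]
  norm_num

theorem le_rpow_half_of_sq_le {x y : ℝ≥0∞} (h : x ^ 2 ≤ y) : x ≤ y ^ (1 / 2 : ℝ) := by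
  rw [← sq_rpow_half x]
  gcongr

theorem hardyNorm_congr {Y : Type*} [NormedAddCommGroup Y] {f g : ℂ → Y}
    (h : EqOn f g (ball 0 1)) : hardyNorm f = hardyNorm g := by
  refine iSup_congr fun r => iSup_congr fun hr => ?_
  congr 1
  funext θ
  refine h ?_
  rw [mem_ball_zero_iff, norm_circleMap_zero, abs_of_pos hr.1]
  exact hr.2

variable {E : Type*} [NormedAddCommGroup E] [InnerProductSpace ℂ E] [CompleteSpace E] {v : ℕ → E}

theorem eLpNorm_powerSum_sq (hv : SubExp v) {r : ℝ} (hr : r ∈ Ioo (0 : ℝ) 1) :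
    eLpNorm (fun θ : ℝ => powerSum v (circleMap 0 r θ)) 2 angleMeasure ^ 2 =
      ∑' m : ℕ, ENNReal.ofReal (r ^ (2 * m)) * ‖v m‖ₑ ^ 2 := by
  have h := eLpNorm_nnreal_pow_eq_lintegral (f := fun θ : ℝ => powerSum v (circleMap 0 r θ))
    (μ := angleMeasure) (p := 2) two_ne_zero
  simp only [NNReal.coe_ofNat, ENNReal.rpow_ofNat, ENNReal.coe_ofNat] at h
  have hpi : ENNReal.ofReal (2 * Real.pi) ≠ 0 := by
    simpa using Real.pi_pos
  have h2 := lintegral_enorm_tsum_pow_sq 0 hr.1.le (hv r hr.1 hr.2)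
  rw [zero_add] at h2
  rw [h, angleMeasure, lintegral_smul_measure, smul_eq_mul]
  simp only [powerSum]
  rw [h2, ← mul_assoc, ENNReal.inv_mul_cancel hpi ENNReal.ofReal_ne_top, one_mul]

/-- The `H ^ 2` norm is the `ℓ ^ 2` norm of the sequence of Taylor coefficients. -/
theorem hardyNorm_powerSum_sq (hv : SubExp v) :
    hardyNorm (powerSum v) ^ 2 = ∑' m : ℕ, ‖v m‖ₑ ^ 2 := by
  apply le_antisymm
  · rw [← rpow_half_sq (∑' m : ℕ, ‖v m‖ₑ ^ 2)]
    gcongr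
    refine iSup₂_le fun r hr => le_rpow_half_of_sq_le ?_
    rw [eLpNorm_powerSum_sq hv hr]
    refine ENNReal.tsum_le_tsum fun m => mul_le_of_le_one_left zero_le ?_
    exact ENNReal.ofReal_le_one.2 (pow_le_one₀ hr.1.le hr.2.le)
  · rw [ENNReal.tsum_eq_iSup_sum]
    refine iSup_le fun F => ?_
    -- Each finite partial sum is a limit as `r` tends to one.
    have hlim : Filter.Tendsto (fun r : ℝ => ∑ m ∈ F, ENNReal.ofReal (r ^ (2 * m)) * ‖v m‖ₑ ^ 2)
        (nhdsWithin 1 (Iio 1)) (nhds (∑ m ∈ F, ‖v m‖ₑ ^ 2)) := by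
      refine tendsto_finsetSum F fun m _ => ?_
      have h1 : Filter.Tendsto (fun r : ℝ => ENNReal.ofReal (r ^ (2 * m))) (nhdsWithin 1 (Iio 1))
          (nhds 1) := by
        have : Continuous fun r : ℝ => ENNReal.ofReal (r ^ (2 * m)) :=
          ENNReal.continuous_ofReal.comp (by fun_prop)
        simpa using (this.tendsto 1).mono_left nhdsWithin_le_nhds
      simpa using ENNReal.Tendsto.mul_const h1 (Or.inr (by finiteness))
    refine le_of_tendsto hlim ?_
    filter_upwards [Ioo_mem_nhdsLT (show (0 : ℝ) < 1 by norm_num)] with r hr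
    refine (ENNReal.sum_le_tsum F).trans ?_
    rw [← eLpNorm_powerSum_sq hv hr]
    gcongr
    exact le_iSup₂ (f := fun (r : ℝ) (_ : r ∈ Ioo (0 : ℝ) 1) =>
      eLpNorm (fun θ : ℝ => powerSum v (circleMap 0 r θ)) 2 angleMeasure) r hr

end HardyNorm

/-! ### Polar coordinates with a logarithmic radius -/

section Polar

/-- Polar coordinates on the unit disc, with the angle in an interval of length `2 π`. -/
theorem lintegral_ball_eq_polar {g : ℂ → ℝ≥0∞} (hg : Measurable g) :
    ∫⁻ z in ball (0 : ℂ) 1, g z = ∫⁻ r in Ioo (0 : ℝ) 1, ENNReal.ofReal r *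
      ∫⁻ θ in Ioc (-Real.pi) (-Real.pi + 2 * Real.pi), g (circleMap 0 r θ) := by
  have hG : Measurable ((ball (0 : ℂ) 1).indicator g) := hg.indicator measurableSet_ball
  have hsymm : ∀ p : ℝ × ℝ, Complex.polarCoord.symm p = circleMap 0 p.1 p.2 := fun p => by
    rw [Complex.polarCoord_symm_apply, circleMap_zero, Complex.exp_mul_I, Complex.ofReal_cos,
      Complex.ofReal_sin]
  have hcm : Measurable fun p : ℝ × ℝ => circleMap 0 p.1 p.2 := by
    simp only [circleMap_zero]
    fun_prop
  rw [← lintegral_indicator measurableSet_ball, ← Complex.lintegral_comp_polarCoord_symm]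
  simp only [hsymm, smul_eq_mul]
  have htarget : polarCoord.target = Ioi (0 : ℝ) ×ˢ Ioo (-Real.pi) Real.pi := rfl
  have hm : Measurable fun p : ℝ × ℝ =>
      ENNReal.ofReal p.1 * (ball (0 : ℂ) 1).indicator g (circleMap 0 p.1 p.2) :=
    (by fun_prop : Measurable fun p : ℝ × ℝ => ENNReal.ofReal p.1).mul (hG.comp hcm)
  rw [htarget, Measure.volume_eq_prod, ← Measure.prod_restrict, lintegral_prod _ hm.aemeasurable,
    ← lintegral_indicator measurableSet_Ioi, ← lintegral_indicator measurableSet_Ioo]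
  refine lintegral_congr fun r => ?_
  by_cases h0 : 0 < r
  · rw [indicator_of_mem (show r ∈ Ioi 0 from h0)]
    by_cases h1 : r < 1
    · rw [indicator_of_mem (show r ∈ Ioo 0 1 from ⟨h0, h1⟩),
        lintegral_const_mul' _ _ ENNReal.ofReal_ne_top,
        show -Real.pi + 2 * Real.pi = Real.pi by ring, setLIntegral_congr Ioo_ae_eq_Ioc]
      congr 1
      refine lintegral_congr fun θ => indicator_of_mem ?_ g
      rwa [mem_ball_zero_iff, norm_circleMap_zero, abs_of_pos h0]
    · rw [indicator_of_notMem (show r ∉ Ioo 0 1 from fun h => h1 h.2)]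
      refine (lintegral_congr fun θ => ?_).trans lintegral_zero
      rw [indicator_of_notMem, mul_zero]
      rwa [mem_ball_zero_iff, norm_circleMap_zero, abs_of_pos h0]
  · rw [indicator_of_notMem (show r ∉ Ioi 0 from h0),
      indicator_of_notMem (show r ∉ Ioo 0 1 from fun h => h0 h.1)]

/-- The substitution `r = e ^ (-s / 2)`. -/
theorem lintegral_Ioo_eq_exp (F : ℝ → ℝ≥0∞) :
    ∫⁻ r in Ioo (0 : ℝ) 1, F r = ∫⁻ s in Ioi (0 : ℝ),
      ENNReal.ofReal (Real.exp (-s / 2) / 2) * F (Real.exp (-s / 2)) := by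
  have himg : (fun s : ℝ => Real.exp (-s / 2)) '' Ioi 0 = Ioo 0 1 := by
    ext r
    constructor
    · rintro ⟨s, hs, rfl⟩
      exact ⟨Real.exp_pos _, Real.exp_lt_one_iff.2 (by linarith [mem_Ioi.1 hs])⟩
    · rintro ⟨h0, h1⟩
      refine ⟨-2 * Real.log r, ?_, ?_⟩
      · rw [mem_Ioi]
        linarith [Real.log_neg h0 h1]
      · simp only
        rw [show -(-2 * Real.log r) / 2 = Real.log r by ring, Real.exp_log h0]
  have hd : ∀ s ∈ Ioi (0 : ℝ), HasDerivWithinAt (fun s : ℝ => Real.exp (-s / 2))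
      (Real.exp (-s / 2) * (-1 / 2)) (Ioi 0) s := fun s _ =>
    (((hasDerivAt_id s).neg.div_const 2).exp).hasDerivWithinAt
  rw [← himg, lintegral_image_eq_lintegral_abs_deriv_mul measurableSet_Ioi hd]
  · refine lintegral_congr fun s => ?_
    congr 2
    rw [abs_mul, abs_of_pos (Real.exp_pos _), abs_of_neg (by norm_num)]
    ring
  · intro x _ y _ h
    have := Real.exp_injective h
    linarith

end Polar

/-! ### The Carleson integral -/

section Carleson

variable {H : Type*} [NormedAddCommGroup H] [InnerProductSpace ℂ H] [CompleteSpace H]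
  {α : ℝ} {φ : ℂ → H →L[ℂ] H} {f : ℂ → H}

theorem powerSum_rpowMul (β : ℝ) (φ : ℂ → H →L[ℂ] H) :
    powerSum (rpowMul β (taylorCoeff φ)) = fracDiff β φ := by
  funext z
  refine tsum_congr fun n => ?_
  rw [rpowMul, smul_smul]

/-- The Carleson integral is the sum of the energies of the Fourier modes. -/
theorem lintegral_carleson (hφ : φ ∈ Hol (H →L[ℂ] H)) (hf : f ∈ HolExt H) :
    ∫⁻ z in ball (0 : ℂ) 1, ‖fracDiff (1 + α) φ z (f (conj z))‖ₑ ^ 2 *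
        ENNReal.ofReal (1 - ‖z‖ ^ 2) =
      ENNReal.ofReal Real.pi * ∑' n : ℤ, modeEnergy α (taylorCoeff φ) (taylorCoeff f) n := by
  have ha := subExp_taylorCoeff hφ
  have hc := expDecay_taylorCoeff hf
  have hu := ha.rpowMul (1 + α)
  have hfH := HolExt.subset_hol hf
  rw [← powerSum_rpowMul]
  set u := rpowMul (1 + α) (taylorCoeff φ) with hudef
  set g₀ : ℂ → ℝ≥0∞ := fun z => ‖powerSum u z (f (conj z))‖ₑ ^ 2 * ENNReal.ofReal (1 - ‖z‖ ^ 2)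
    with hg₀
  have hconj : MapsTo (fun z : ℂ => conj z) (ball 0 1) (ball 0 1) := fun z hz => by
    simpa using hz
  -- `f` is arbitrary outside the disc: in general only the truncated integrand is measurable.
  have hmeas : Measurable ((ball (0 : ℂ) 1).indicator g₀) := by
    classical
    have h1 : ContinuousOn (fun z => ‖powerSum u z (f (conj z))‖ₑ) (ball 0 1) :=
      continuous_enorm.comp_continuousOn ((powerSum_mem_hol hu).continuousOn.clm_apply
        (hfH.continuousOn.comp Complex.continuous_conj.continuousOn hconj))
    have h2 : Measurable ((ball (0 : ℂ) 1).indicator fun z => ‖powerSum u z (f (conj z))‖ₑ) := by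
      rw [← piecewise_eq_indicator]
      exact h1.measurable_piecewise continuousOn_const measurableSet_ball
    have h3 : (ball (0 : ℂ) 1).indicator g₀ = fun z =>
        ((ball (0 : ℂ) 1).indicator (fun z => ‖powerSum u z (f (conj z))‖ₑ) z) ^ 2 *
          ENNReal.ofReal (1 - ‖z‖ ^ 2) := by
      funext z
      by_cases hz : z ∈ ball (0 : ℂ) 1
      · rw [indicator_of_mem hz, indicator_of_mem hz]
      · rw [indicator_of_notMem hz, indicator_of_notMem hz, zero_pow two_ne_zero, zero_mul]
    rw [h3]
    exact (h2.pow_const 2).mul (by fun_prop)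
  have hball : ∫⁻ z in ball (0 : ℂ) 1, g₀ z =
      ∫⁻ z in ball (0 : ℂ) 1, (ball (0 : ℂ) 1).indicator g₀ z :=
    setLIntegral_congr_fun measurableSet_ball fun z hz => (indicator_of_mem hz g₀).symm
  have hm : ∀ n : ℤ, AEMeasurable (fun s : ℝ =>
      ENNReal.ofReal ((1 - Real.exp (-s)) * Real.exp (-(1 + (n : ℝ)) * s)) *
        ‖mode α (taylorCoeff φ) (taylorCoeff f) n s‖ₑ ^ 2) (volume.restrict (Ioi 0)) := fun n =>
    (by fun_prop : Measurable fun s : ℝ => ENNReal.ofReal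
      ((1 - Real.exp (-s)) * Real.exp (-(1 + (n : ℝ)) * s))).aemeasurable.mul
      (aemeasurable_enorm_sq measurableSet_Ioi (continuousOn_mode ha hc n))
  rw [hball, lintegral_ball_eq_polar hmeas, lintegral_Ioo_eq_exp]
  simp only [modeEnergy]
  rw [← lintegral_tsum hm, ← lintegral_const_mul' _ _ ENNReal.ofReal_ne_top]
  refine setLIntegral_congr_fun measurableSet_Ioi fun s hs => ?_
  have hs0 : (0 : ℝ) < s := hs
  have hr0 := Real.exp_pos (-s / 2)
  have hr1 : Real.exp (-s / 2) < 1 := Real.exp_lt_one_iff.2 (by linarith)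
  have hr2 : Real.exp (-s / 2) ^ 2 = Real.exp (-s) := by
    rw [← Real.exp_nat_mul]
    congr 1
    push_cast
    ring
  have hz : ∀ θ, circleMap 0 (Real.exp (-s / 2)) θ ∈ ball (0 : ℂ) 1 := fun θ => by
    rwa [mem_ball_zero_iff, norm_circleMap_zero, abs_of_pos hr0]
  have h0 : 0 ≤ 1 - Real.exp (-s) := by
    linarith [Real.exp_lt_one_iff.2 (neg_lt_zero.2 hs0)]
  have h1 : ∀ θ, (ball (0 : ℂ) 1).indicator g₀ (circleMap 0 (Real.exp (-s / 2)) θ) =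
      ‖(∑' k : ℕ, circleMap 0 (Real.exp (-s / 2)) θ ^ k • u k)
        (∑' m : ℕ, conj (circleMap 0 (Real.exp (-s / 2)) θ) ^ m • taylorCoeff f m)‖ₑ ^ 2 *
        ENNReal.ofReal (1 - Real.exp (-s)) := fun θ => by
    rw [indicator_of_mem (hz θ)]
    simp only [hg₀]
    rw [norm_circleMap_zero, abs_of_pos hr0, hr2,
      eqOn_powerSum_taylorCoeff hfH (hconj (hz θ))]
    rfl
  simp_rw [h1]
  rw [lintegral_mul_const' _ _ ENNReal.ofReal_ne_top, lintegral_enorm_mul_conj_sq_exp _ hs0 hu hc]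
  calc _ = ENNReal.ofReal Real.pi * ∑' n : ℤ, (ENNReal.ofReal (Real.exp (-s / 2) / 2) *
        ENNReal.ofReal (Real.exp (-s / 2)) * 2 * ENNReal.ofReal (1 - Real.exp (-s))) *
        (ENNReal.ofReal (Real.exp (-n * s)) * ‖mode α (taylorCoeff φ) (taylorCoeff f) n s‖ₑ ^ 2) := by
        rw [ENNReal.tsum_mul_left, ENNReal.ofReal_mul (by norm_num : (0 : ℝ) ≤ 2), ENNReal.ofReal_ofNat]
        simp only [mode, hudef]
        ring
    _ = _ := by
        congr 1
        refine tsum_congr fun n => ?_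
        rw [← mul_assoc, ← ENNReal.ofReal_ofNat 2, ← ENNReal.ofReal_mul (by positivity),
          ← ENNReal.ofReal_mul (by positivity), ← ENNReal.ofReal_mul (by positivity),
          ← ENNReal.ofReal_mul (by positivity)]
        congr 2
        rw [show -(1 + (n : ℝ)) * s = -s + -n * s by ring, Real.exp_add, ← hr2]
        ring

end Carleson

/-! ### The operator `D ^ α Γ_φ` -/

section Operator

/-- `Γ_φ f` is analytic on the unit disc. -/
theorem subExp_hankelCoeff {H : Type*} [NormedAddCommGroup H] [NormedSpace ℂ H]
    {a : ℕ → H →L[ℂ] H} {c : ℕ → H} (ha : SubExp a) (hc : ExpDecay c) :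
    SubExp (hankelCoeff a c) := by
  obtain ⟨R, hR, hs⟩ := hc
  have hR0 : 0 < R := one_pos.trans hR
  intro r h0 h1
  obtain ⟨q, hq, hq1⟩ := exists_between (max_lt (inv_lt_one_of_one_lt₀ hR) h1)
  have hRq : R⁻¹ < q := (le_max_left _ _).trans_lt hq
  have hrq : r < q := (le_max_right _ _).trans_lt hq
  have hq0 : 0 < q := h0.trans hrq
  obtain ⟨K, hK, hb⟩ := ha.exists_bound hq0 hq1
  have hterm : ∀ n m : ℕ, ‖a (m + n) (c m)‖ ≤ K * (q ^ n)⁻¹ * (‖c m‖ * R ^ m) := fun n m => by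
    have h2 : ‖a (m + n)‖ ≤ K * (q ^ (m + n))⁻¹ := by
      rw [← div_eq_mul_inv, le_div_iff₀ (by positivity)]
      exact hb _
    calc ‖a (m + n) (c m)‖ ≤ K * (q ^ (m + n))⁻¹ * ‖c m‖ :=
          ((a (m + n)).le_opNorm (c m)).trans (by gcongr)
      _ = K * (q ^ n)⁻¹ * (‖c m‖ * q⁻¹ ^ m) := by
          rw [pow_add, inv_pow, mul_inv]
          ring
      _ ≤ _ := by
          gcongr
          exact (inv_lt_of_inv_lt₀ hR0 hRq).le
  refine Summable.of_nonneg_of_le (fun n => by positivity) (fun n => ?_)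
    ((summable_geometric_of_lt_one (r := r / q) (by positivity)
      ((div_lt_one hq0).2 hrq)).mul_left (K * ∑' m, ‖c m‖ * R ^ m))
  have h3 : ‖hankelCoeff a c n‖ ≤ K * (q ^ n)⁻¹ * ∑' m, ‖c m‖ * R ^ m :=
    tsum_of_norm_bounded (hs.hasSum.mul_left _) (hterm n)
  calc ‖hankelCoeff a c n‖ * r ^ n ≤ K * (q ^ n)⁻¹ * (∑' m, ‖c m‖ * R ^ m) * r ^ n := by gcongr
    _ = _ := by
      rw [div_pow]
      field_simp

theorem ExpDecay.tsum_enorm_sq_ne_top {H : Type*} [NormedAddCommGroup H] {c : ℕ → H}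
    (hc : ExpDecay c) : ∑' m, ‖c m‖ₑ ^ 2 ≠ ∞ := by
  have h1 := hc.summable_norm
  have h2 : ∑' m, ‖c m‖ₑ ≠ ∞ := by
    simp_rw [← ofReal_norm]
    rw [← ENNReal.ofReal_tsum_of_nonneg (fun _ => norm_nonneg _) h1]
    exact ENNReal.ofReal_ne_top
  refine ne_top_of_le_ne_top (ENNReal.mul_ne_top h2 h2) ?_
  rw [← ENNReal.tsum_mul_left]
  refine ENNReal.tsum_le_tsum fun m => ?_
  rw [sq]
  gcongr
  exact ENNReal.le_tsum m

variable {H : Type*} [NormedAddCommGroup H] [InnerProductSpace ℂ H] [CompleteSpace H]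
  {α : ℝ} {φ : ℂ → H →L[ℂ] H} {f : ℂ → H}

/-- The `H ^ 2` norm of `D ^ α Γ_φ f` in terms of the Taylor coefficients of `φ` and `f`. -/
theorem hardyNorm_fracDiff_hankel_sq (hφ : φ ∈ Hol (H →L[ℂ] H)) (hf : f ∈ HolExt H) :
    hardyNorm (fracDiff α (hankel φ f)) ^ 2 = ∑' n : ℕ, (ENNReal.ofReal ((1 + (n : ℝ)) ^ α) *
      ‖hankelCoeff (taylorCoeff φ) (taylorCoeff f) n‖ₑ) ^ 2 := by
  have hg := subExp_hankelCoeff (subExp_taylorCoeff hφ) (expDecay_taylorCoeff hf)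
  have h1 : hankel φ f = powerSum (hankelCoeff (taylorCoeff φ) (taylorCoeff f)) := rfl
  set g := hankelCoeff (taylorCoeff φ) (taylorCoeff f) with hgdef
  have h2 : fracDiff α (hankel φ f) =
      powerSum fun n => (((1 + (n : ℝ)) ^ α : ℝ) : ℂ) • g n := by
    funext z
    refine tsum_congr fun n => ?_
    rw [h1, taylorCoeff_powerSum hg, smul_smul]
  have h3 : SubExp fun n : ℕ => (((1 + (n : ℝ)) ^ α : ℝ) : ℂ) • g n := hg.of_norm_le α fun n => by
    rw [norm_smul, Complex.norm_real, Real.norm_of_nonneg (by positivity)]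
  rw [h2, hardyNorm_powerSum_sq h3]
  refine tsum_congr fun n => ?_
  rw [enorm_smul, ← ofReal_norm (((1 + (n : ℝ)) ^ α : ℝ) : ℂ), Complex.norm_real,
    Real.norm_of_nonneg (by positivity)]

theorem hardyNorm_sq (hf : f ∈ HolExt H) : hardyNorm f ^ 2 = ∑' m : ℕ, ‖taylorCoeff f m‖ₑ ^ 2 := by
  have hfH := HolExt.subset_hol hf
  rw [hardyNorm_congr (eqOn_powerSum_taylorCoeff hfH), hardyNorm_powerSum_sq (subExp_taylorCoeff hfH)]

/-- The bound of `D ^ α Γ_φ` by its operator norm, in terms of Taylor coefficients. -/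
theorem tsum_hankelCoeff_sq_le_hardyOpNorm (hφ : φ ∈ Hol (H →L[ℂ] H)) {c : ℕ → H}
    (hc : ExpDecay c) :
    ∑' n : ℕ, (ENNReal.ofReal ((1 + (n : ℝ)) ^ α) * ‖hankelCoeff (taylorCoeff φ) c n‖ₑ) ^ 2 ≤
      hardyOpNorm (fun f => fracDiff α (hankel φ f)) ^ 2 * ∑' m, ‖c m‖ₑ ^ 2 := by
  set σ := ∑' m, ‖c m‖ₑ ^ 2 with hσ
  have hσtop : σ ≠ ∞ := hc.tsum_enorm_sq_ne_top
  rcases eq_or_ne σ 0 with h0 | h0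
  -- The zero sequence cannot be normalized; here both sides vanish.
  · have hc0 : ∀ m, c m = 0 := fun m => by
      have := ENNReal.tsum_eq_zero.1 h0 m
      simpa using this
    simp [hankelCoeff, hc0]
  · set t : ℝ := (√σ.toReal)⁻¹ with ht
    have hσ0 : 0 < σ.toReal := ENNReal.toReal_pos h0 hσtop
    have htσ : ENNReal.ofReal (t ^ 2) * σ = 1 := by
      rw [ht, inv_pow, Real.sq_sqrt hσ0.le, ← ENNReal.ofReal_toReal hσtop,
        ENNReal.toReal_ofReal hσ0.le, ← ENNReal.ofReal_mul (by positivity),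
        inv_mul_cancel₀ hσ0.ne', ENNReal.ofReal_one]
    have ht0 : 0 ≤ t := by positivity
    have hen : ∀ x : H, ‖(t : ℂ) • x‖ₑ ^ 2 = ENNReal.ofReal (t ^ 2) * ‖x‖ₑ ^ 2 := fun x => by
      rw [enorm_smul, mul_pow, ← ofReal_norm, Complex.norm_real, Real.norm_of_nonneg ht0,
        ENNReal.ofReal_pow ht0]
    have hc' : ExpDecay fun m => (t : ℂ) • c m := by
      obtain ⟨R, hR, hs⟩ := hc
      refine ⟨R, hR, (hs.mul_left t).congr fun m => ?_⟩
      rw [norm_smul, Complex.norm_real, Real.norm_of_nonneg ht0, mul_assoc]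
    set F := powerSum fun m => (t : ℂ) • c m with hF
    have hFE : F ∈ HolExt H := powerSum_mem_holExt hc'
    have hFs : SubExp fun m => (t : ℂ) • c m := fun r h0 h1 => hc'.summable_mul_pow h0.le h1.le
    have hFt : taylorCoeff F = fun m => (t : ℂ) • c m := funext fun m => taylorCoeff_powerSum hFs m
    have hF1 : hardyNorm F = 1 := by
      have h1 : hardyNorm F ^ 2 = 1 := by
        rw [hardyNorm_powerSum_sq hFs]
        simp_rw [hen]
        rw [ENNReal.tsum_mul_left, ← hσ, htσ]
      rw [← sq_rpow_half (hardyNorm F), h1, ENNReal.one_rpow]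
    have h2 : hardyNorm (fracDiff α (hankel φ F)) ≤
        hardyOpNorm (fun f => fracDiff α (hankel φ f)) :=
      le_iSup₂ (f := fun (f : ℂ → H) (_ : f ∈ HolExtOne H) =>
        hardyNorm (fracDiff α (hankel φ f))) F ⟨hFE, hF1⟩
    have h3 : hardyNorm (fracDiff α (hankel φ F)) ^ 2 = ENNReal.ofReal (t ^ 2) *
        ∑' n : ℕ, (ENNReal.ofReal ((1 + (n : ℝ)) ^ α) *
          ‖hankelCoeff (taylorCoeff φ) c n‖ₑ) ^ 2 := by
      rw [hardyNorm_fracDiff_hankel_sq hφ hFE, hFt, ← ENNReal.tsum_mul_left]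
      refine tsum_congr fun n => ?_
      have h4 : hankelCoeff (taylorCoeff φ) (fun m => (t : ℂ) • c m) n =
          (t : ℂ) • hankelCoeff (taylorCoeff φ) c n := by
        simp only [hankelCoeff, map_smul]
        rw [tsum_const_smul'']
      rw [h4, mul_pow, hen, mul_pow]
      ring
    have h5 : ENNReal.ofReal (t ^ 2) * ∑' n : ℕ, (ENNReal.ofReal ((1 + (n : ℝ)) ^ α) *
          ‖hankelCoeff (taylorCoeff φ) c n‖ₑ) ^ 2 ≤
        hardyOpNorm (fun f => fracDiff α (hankel φ f)) ^ 2 := by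
      rw [← h3]
      gcongr
    calc _ = (ENNReal.ofReal (t ^ 2) * ∑' n : ℕ, (ENNReal.ofReal ((1 + (n : ℝ)) ^ α) *
          ‖hankelCoeff (taylorCoeff φ) c n‖ₑ) ^ 2) * σ := by
          rw [mul_right_comm, htσ, one_mul]
      _ ≤ _ := mul_le_mul_left h5 _

theorem hardyNorm_le_hardyOpNorm_mul (hφ : φ ∈ Hol (H →L[ℂ] H)) (hf : f ∈ HolExt H) :
    hardyNorm (fracDiff α (hankel φ f)) ≤
      hardyOpNorm (fun f => fracDiff α (hankel φ f)) * hardyNorm f := by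
  have h := tsum_hankelCoeff_sq_le_hardyOpNorm (α := α) hφ (expDecay_taylorCoeff hf)
  rw [← hardyNorm_fracDiff_hankel_sq hφ hf, ← hardyNorm_sq hf, ← mul_pow] at h
  exact (ENNReal.pow_le_pow_left_iff two_ne_zero).1 h

theorem hardyBounded_iff (hφ : φ ∈ Hol (H →L[ℂ] H)) :
    HardyBounded (fun f => fracDiff α (hankel φ f)) ↔
      hardyOpNorm (fun f => fracDiff α (hankel φ f)) < ∞ := by
  constructor
  · rintro ⟨C, hC⟩
    refine lt_of_le_of_lt (iSup₂_le fun f hf => ?_) (ENNReal.coe_lt_top (r := C))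
    have := hC f hf.1
    rwa [hf.2, mul_one] at this
  · intro h
    refine ⟨(hardyOpNorm (fun f => fracDiff α (hankel φ f))).toNNReal, fun f hf => ?_⟩
    rw [ENNReal.coe_toNNReal h.ne]
    exact hardyNorm_le_hardyOpNorm_mul hφ hf

theorem fracDiff_mem_hol (hφ : φ ∈ Hol (H →L[ℂ] H)) (β : ℝ) :
    fracDiff β φ ∈ Hol (H →L[ℂ] H) := by
  rw [← powerSum_rpowMul]
  exact powerSum_mem_hol ((subExp_taylorCoeff hφ).rpowMul β)

/-- The identity `D D ^ α φ = D ^ (1 + α) φ`, valid where the power series converges. -/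
theorem diffOp_fracDiff (hφ : φ ∈ Hol (H →L[ℂ] H)) :
    EqOn (diffOp (fracDiff α φ)) (fracDiff (1 + α) φ) (ball 0 1) := by
  intro z hz
  rw [← powerSum_rpowMul, ← powerSum_rpowMul,
    diffOp_powerSum ((subExp_taylorCoeff hφ).rpowMul α) (by simpa using hz)]
  refine tsum_congr fun n => ?_
  rw [rpowMul, rpowMul, mul_smul, smul_smul (1 + (n : ℂ)),
    add_comm 1 α, Real.rpow_add_one (by positivity)]
  congr 2
  push_cast
  ring

end Operator

/-! ### The two norm inequalities -/

section NormInequalities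

variable {H : Type*} [NormedAddCommGroup H] [InnerProductSpace ℂ H] [CompleteSpace H]
  {α : ℝ} {φ : ℂ → H →L[ℂ] H}

theorem antiCarleson_diffOp_fracDiff (hφ : φ ∈ Hol (H →L[ℂ] H)) :
    antiCarleson (diffOp (fracDiff α φ)) = antiCarleson (fracDiff (1 + α) φ) := by
  refine iSup_congr fun f => iSup_congr fun _ => ?_
  refine setLIntegral_congr_fun measurableSet_ball fun z hz => ?_
  rw [diffOp_fracDiff hφ hz]

theorem rpow_half_ofReal_mul_sq (x : ℝ) (y : ℝ≥0∞) :
    (ENNReal.ofReal x * y ^ 2) ^ (1 / 2 : ℝ) = ENNReal.ofReal x ^ (1 / 2 : ℝ) * y := by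
  rw [ENNReal.mul_rpow_of_nonneg _ _ (by norm_num), sq_rpow_half]

/-- The factor `π` in `lintegral_carleson` is at least one and is dropped. -/
theorem hardyOpNorm_le_antiCarleson (hα : 0 < α) (hφ : φ ∈ Hol (H →L[ℂ] H)) :
    hardyOpNorm (fun f => fracDiff α (hankel φ f)) ≤
      ENNReal.ofReal ((Real.Gamma (2 * α + 1) + Real.Gamma (2 * α)) / Real.Gamma (1 + α) ^ 2) ^
        (1 / 2 : ℝ) * antiCarleson (fracDiff (1 + α) φ) ^ (1 / 2 : ℝ) := by
  refine iSup₂_le fun f hf => ?_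
  rw [← ENNReal.mul_rpow_of_nonneg _ _ (by norm_num)]
  refine le_rpow_half_of_sq_le ?_
  rw [hardyNorm_fracDiff_hankel_sq hφ hf.1]
  refine (tsum_hankelCoeff_sq_le hα (subExp_taylorCoeff hφ) (expDecay_taylorCoeff hf.1)).trans ?_
  gcongr
  have h1 : ∫⁻ z in ball (0 : ℂ) 1, ‖fracDiff (1 + α) φ z (f (conj z))‖ₑ ^ 2 *
      ENNReal.ofReal (1 - ‖z‖ ^ 2) ≤ antiCarleson (fracDiff (1 + α) φ) :=
    le_iSup₂ (f := fun (f : ℂ → H) (_ : f ∈ HolExtOne H) => ∫⁻ z in ball (0 : ℂ) 1,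
      ‖fracDiff (1 + α) φ z (f (conj z))‖ₑ ^ 2 * ENNReal.ofReal (1 - ‖z‖ ^ 2)) f hf
  rw [lintegral_carleson hφ hf.1] at h1
  refine le_trans (le_mul_of_one_le_left zero_le ?_) h1
  exact ENNReal.one_le_ofReal.2 (by linarith [Real.pi_gt_three])

theorem antiCarleson_le_hardyOpNorm (hα : 0 < α) (hφ : φ ∈ Hol (H →L[ℂ] H)) :
    antiCarleson (fracDiff (1 + α) φ) ^ (1 / 2 : ℝ) ≤
      ENNReal.ofReal (Real.pi * carlesonConst α) ^ (1 / 2 : ℝ) *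
        hardyOpNorm (fun f => fracDiff α (hankel φ f)) := by
  rw [← rpow_half_ofReal_mul_sq]
  gcongr
  refine iSup₂_le fun f hf => ?_
  rw [lintegral_carleson hφ hf.1, ENNReal.ofReal_mul Real.pi_pos.le, mul_assoc]
  gcongr
  have h1 := tsum_modeEnergy_le hα (subExp_taylorCoeff hφ) (expDecay_taylorCoeff hf.1)
    (fun c hc => tsum_hankelCoeff_sq_le_hardyOpNorm (α := α) hφ hc)
  rwa [← hardyNorm_sq hf.1, hf.2, one_pow, mul_one] at h1

end NormInequalities

end VectorHankel

theorem theorem1 (α : ℝ) (hα : 0 < α) :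
    ∃ C : ℝ≥0, 0 < C ∧
      ∀ (H : Type*) [NormedAddCommGroup H] [InnerProductSpace ℂ H] [CompleteSpace H]
        [TopologicalSpace.SeparableSpace H] (φ : ℂ → H →L[ℂ] H),
        φ ∈ Hol (H →L[ℂ] H) →
          (HardyBounded (fun f => fracDiff α (hankel φ f)) ↔ fracDiff α φ ∈ BMOACarleson H) ∧
          (HardyBounded (fun f => fracDiff α (hankel φ f)) ↔
            hardyOpNorm (fun f => fracDiff α (hankel φ f)) < ∞) ∧
          (fracDiff α φ ∈ BMOACarleson H ↔ antiCarleson (fracDiff (1 + α) φ) < ∞) ∧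
          carlesonNorm (fracDiff α φ) = antiCarleson (fracDiff (1 + α) φ) ^ (1 / 2 : ℝ) ∧
          hardyOpNorm (fun f => fracDiff α (hankel φ f)) ≤ C * carlesonNorm (fracDiff α φ) ∧
          carlesonNorm (fracDiff α φ) ≤ C * hardyOpNorm (fun f => fracDiff α (hankel φ f)) := by
  set c₁ : ℝ≥0 := (ENNReal.ofReal ((Real.Gamma (2 * α + 1) + Real.Gamma (2 * α)) /
    Real.Gamma (1 + α) ^ 2) ^ (1 / 2 : ℝ)).toNNReal with hc₁
  set c₂ : ℝ≥0 := (ENNReal.ofReal (Real.pi * carlesonConst α) ^ (1 / 2 : ℝ)).toNNReal with hc₂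
  have hc₁' : (c₁ : ℝ≥0∞) = ENNReal.ofReal ((Real.Gamma (2 * α + 1) + Real.Gamma (2 * α)) /
      Real.Gamma (1 + α) ^ 2) ^ (1 / 2 : ℝ) :=
    ENNReal.coe_toNNReal (ENNReal.rpow_ne_top_of_nonneg (by norm_num) ENNReal.ofReal_ne_top)
  have hc₂' : (c₂ : ℝ≥0∞) = ENNReal.ofReal (Real.pi * carlesonConst α) ^ (1 / 2 : ℝ) :=
    ENNReal.coe_toNNReal (ENNReal.rpow_ne_top_of_nonneg (by norm_num) ENNReal.ofReal_ne_top)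
  -- The constants of the two inequalities; the maximum with `1` makes the result positive.
  refine ⟨max (max c₁ c₂) 1, lt_max_of_lt_right one_pos, ?_⟩
  intro H _ _ _ _ φ hφ
  have hnorm : carlesonNorm (fracDiff α φ) = antiCarleson (fracDiff (1 + α) φ) ^ (1 / 2 : ℝ) := by
    rw [carlesonNorm, antiCarleson_diffOp_fracDiff hφ]
  have hmem : fracDiff α φ ∈ BMOACarleson H ↔ carlesonNorm (fracDiff α φ) < ∞ :=
    and_iff_right (fracDiff_mem_hol hφ α)
  have hle₁ : hardyOpNorm (fun f => fracDiff α (hankel φ f)) ≤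
      ((max (max c₁ c₂) 1 : ℝ≥0) : ℝ≥0∞) * carlesonNorm (fracDiff α φ) := by
    rw [hnorm]
    refine (hardyOpNorm_le_antiCarleson hα hφ).trans ?_
    rw [← hc₁']
    gcongr
    exact (le_max_left _ _).trans (le_max_left _ _)
  have hle₂ : carlesonNorm (fracDiff α φ) ≤
      ((max (max c₁ c₂) 1 : ℝ≥0) : ℝ≥0∞) * hardyOpNorm (fun f => fracDiff α (hankel φ f)) := by
    rw [hnorm]
    refine (antiCarleson_le_hardyOpNorm hα hφ).trans ?_
    rw [← hc₂']
    gcongr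
    exact (le_max_right _ _).trans (le_max_left _ _)
  refine ⟨?_, hardyBounded_iff hφ, ?_, hnorm, hle₁, hle₂⟩
  · rw [hardyBounded_iff hφ, hmem]
    exact ⟨fun h => hle₂.trans_lt (ENNReal.mul_lt_top ENNReal.coe_lt_top h),
      fun h => hle₁.trans_lt (ENNReal.mul_lt_top ENNReal.coe_lt_top h)⟩
  · rw [hmem, hnorm, ENNReal.rpow_lt_top_iff_of_pos (by norm_num)]
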